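/- Let $T'$ be a path with $t$ vertices $p_1,\dots,p_t$; a subpath of $T'$ is a non-empty set of consecutive vertices of $T'$. A representation of a finite simple graph $G$ in $T'$ assigns to every vertex $v$ of $G$ a subpath $R_v$ of $T'$ such that two distinct vertices $u,v$ are adjacent in $G$ if and only if $R_u\cap R_v\neq\emptyset$; it is proper if no $R_u$ is a proper subset of some $R_v$. In the problem $\mathrm{RepExt}(\mathrm{INT},\mathrm{Fixed})$ the input is a graph $G$ with $n$ vertices and $m$ edges, a path $T'$ with $t$ vertices, and prescribed subpaths $R'_v$ of $T'$ for some (possibly none) of the vertices $v$ of $G$. The question is whether $G$ has a representation in $T'$ with $R_v=R'_v$ for all vertices $v$ with a prescribed subpath. The problem $\mathrm{RepExt}(\mathrm{PINT},\mathrm{Fixed})$ has the same input and asks for such a representation that is proper. Graphs are given by adjacency lists, prescribed subpaths by their end vertices, and running time is the number of steps of a random access machine whose arithmetic operations are addition and truncated subtraction, at unit cost. Proposition. The problems $\mathrm{RepExt}(\mathrm{PINT},\mathrm{Fixed})$ and $\mathrm{RepExt}(\mathrm{INT},\mathrm{Fixed})$ are fixed-parameter tractable with respect to the parameter $t$. Both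 can be solved in time $O(n+m+f(t))$, where $f(t)=t^{2t^2}$ and the constant of the $O$ is absolute. -/

import Mathlib

namespace RepExt

/-! ## Random access machine with uniform cost

A machine has registers `x₀, x₁, …` and memory arrays `A₀, A₁, …` holding natural numbers. A program
is a fixed finite text and so names finitely many registers and arrays; array cells are addressed
indirectly, through registers. Arithmetic is restricted to addition and truncated subtraction. -/

/-- Contents of the registers and of the memory arrays. -/
@[ext]
structure State where
  reg : ℕ → ℕ
  arr : ℕ → ℕ → ℕ

/-- `x_d := v`. -/
def State.setReg (s : State) (d v : ℕ) : State :=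
  { s with reg := Function.update s.reg d v }

/-- `A_k[i] := v`. -/
def State.setCell (s : State) (k i v : ℕ) : State :=
  { s with arr := Function.update s.arr k (Function.update (s.arr k) i v) }

/-- Programs of the machine. -/
inductive Prog : Type
  /-- do nothing -/
  | skip : Prog
  /-- `x_d := c` -/
  | const (d c : ℕ) : Prog
  /-- `x_d := x_a + x_b` -/
  | add (d a b : ℕ) : Prog
  /-- `x_d := x_a - x_b` (truncated at zero) -/
  | sub (d a b : ℕ) : Prog
  /-- `x_d := A_k[x_a]` -/
  | load (d k a : ℕ) : Prog
  /-- `A_k[x_a] := x_b` -/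
  | store (k a b : ℕ) : Prog
  /-- `p; q` -/
  | seq (p q : Prog) : Prog
  /-- `if x_a < x_b then p else q` -/
  | ite (a b : ℕ) (p q : Prog) : Prog
  /-- `while x_a < x_b do p` -/
  | loop (a b : ℕ) (p : Prog) : Prog

/-- `Exec p s k s'`: program `p` started in state `s` halts in state `s'` after exactly `k` steps.
Every elementary instruction and every evaluation of a test is one step. -/
inductive Exec : Prog → State → ℕ → State → Prop
  | skip (s : State) : Exec .skip s 1 s
  | const (d c : ℕ) (s : State) : Exec (.const d c) s 1 (s.setReg d c)
  | add (d a b : ℕ) (s : State) : Exec (.add d a b) s 1 (s.setReg d (s.reg a + s.reg b))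
  | sub (d a b : ℕ) (s : State) : Exec (.sub d a b) s 1 (s.setReg d (s.reg a - s.reg b))
  | load (d k a : ℕ) (s : State) : Exec (.load d k a) s 1 (s.setReg d (s.arr k (s.reg a)))
  | store (k a b : ℕ) (s : State) :
      Exec (.store k a b) s 1 (s.setCell k (s.reg a) (s.reg b))
  | seq {p q : Prog} {s s' s'' : State} {i j : ℕ} :
      Exec p s i s' → Exec q s' j s'' → Exec (.seq p q) s (i + j) s''
  | ite_true {a b : ℕ} {p q : Prog} {s s' : State} {i : ℕ} :
      s.reg a < s.reg b → Exec p s i s' → Exec (.ite a b p q) s (i + 1) s'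
  | ite_false {a b : ℕ} {p q : Prog} {s s' : State} {i : ℕ} :
      ¬ s.reg a < s.reg b → Exec q s i s' → Exec (.ite a b p q) s (i + 1) s'
  | loop_true {a b : ℕ} {p : Prog} {s s' s'' : State} {i j : ℕ} :
      s.reg a < s.reg b → Exec p s i s' → Exec (.loop a b p) s' j s'' →
        Exec (.loop a b p) s (i + j + 1) s''
  | loop_false {a b : ℕ} {p : Prog} {s : State} :
      ¬ s.reg a < s.reg b → Exec (.loop a b p) s 1 s

/-- The machine is deterministic: the final state and the number of steps are determined. -/
theorem Exec.unique {p : Prog} {s s₁ s₂ : State} {i j : ℕ}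
    (h₁ : Exec p s i s₁) (h₂ : Exec p s j s₂) : i = j ∧ s₁ = s₂ := by
  induction h₁ generalizing j s₂ with
  | skip => cases h₂; exact ⟨rfl, rfl⟩
  | const => cases h₂; exact ⟨rfl, rfl⟩
  | add => cases h₂; exact ⟨rfl, rfl⟩
  | sub => cases h₂; exact ⟨rfl, rfl⟩
  | load => cases h₂; exact ⟨rfl, rfl⟩
  | store => cases h₂; exact ⟨rfl, rfl⟩
  | seq _ _ ih₁ ih₂ =>
    cases h₂ with
    | seq a b =>
      obtain ⟨rfl, rfl⟩ := ih₁ a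
      obtain ⟨rfl, rfl⟩ := ih₂ b
      exact ⟨rfl, rfl⟩
  | ite_true hc _ ih =>
    cases h₂ with
    | ite_true _ a => obtain ⟨rfl, rfl⟩ := ih a; exact ⟨rfl, rfl⟩
    | ite_false hn _ => exact absurd hc hn
  | ite_false hn _ ih =>
    cases h₂ with
    | ite_true hc _ => exact absurd hc hn
    | ite_false _ a => obtain ⟨rfl, rfl⟩ := ih a; exact ⟨rfl, rfl⟩
  | loop_true hc _ _ ih₁ ih₂ =>
    cases h₂ with
    | loop_true _ a b =>
      obtain ⟨rfl, rfl⟩ := ih₁ a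
      obtain ⟨rfl, rfl⟩ := ih₂ b
      exact ⟨rfl, rfl⟩
    | loop_false hn => exact absurd hc hn
  | loop_false hn =>
    cases h₂ with
    | loop_true hc _ _ => exact absurd hc hn
    | loop_false _ => exact ⟨rfl, rfl⟩

/-! ## Subpaths-in-path representations -/

/-- A (non-empty) subpath of the path with vertices `0, 1, …, t - 1` in this order, given by its left
and its right end vertex. -/
@[ext]
structure Subpath (t : ℕ) where
  left : Fin t
  right : Fin t
  left_le_right : left ≤ right

/-- The vertex set of a subpath. -/
def Subpath.verts {t : ℕ} (P : Subpath t) : Set (Fin t) := Set.Icc P.left P.right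

/-- The subpaths are exactly the sets of vertices that induce a connected (non-empty) subgraph of
the path. -/
theorem Subpath.exists_verts_eq_iff {t : ℕ} (S : Set (Fin t)) :
    (∃ P : Subpath t, P.verts = S) ↔ ((SimpleGraph.pathGraph t).induce S).Connected := by
  constructor
  · rintro ⟨P, rfl⟩
    have hl : P.left ∈ P.verts := ⟨le_rfl, P.left_le_right⟩
    have key : ∀ (k : ℕ) (x : Fin t) (hx : x ∈ P.verts), (x : ℕ) = P.left + k →
        ((SimpleGraph.pathGraph t).induce P.verts).Reachable ⟨P.left, hl⟩ ⟨x, hx⟩ := by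
      intro k
      induction k with
      | zero =>
        intro x hx h
        have : P.left = x := Fin.ext (by omega)
        subst this
        exact SimpleGraph.Reachable.refl _
      | succ k ih =>
        intro x hx h
        have hy : (⟨P.left + k, by omega⟩ : Fin t) ∈ P.verts :=
          ⟨Fin.le_def.2 (by simp), Fin.le_def.2 (by have := Fin.le_def.1 hx.2; simp; omega)⟩
        refine (ih _ hy rfl).trans (SimpleGraph.Adj.reachable ?_)
        rw [SimpleGraph.comap_adj, SimpleGraph.pathGraph_adj]
        left
        simp [h]
        omega
    have : Nonempty P.verts := ⟨⟨_, hl⟩⟩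
    refine ⟨fun x y => ?_⟩
    exact (key _ x.1 x.2 (Nat.add_sub_cancel' (Fin.le_def.1 x.2.1)).symm).symm.trans
      (key _ y.1 y.2 (Nat.add_sub_cancel' (Fin.le_def.1 y.2.1)).symm)
  · intro h
    have hne : S.Nonempty := Set.nonempty_coe_sort.1 h.nonempty
    obtain ⟨a, haS, ha⟩ := Set.exists_min_image S id S.toFinite hne
    obtain ⟨b, hbS, hb⟩ := Set.exists_max_image S id S.toFinite hne
    refine ⟨⟨a, b, ha b hbS⟩, Set.Subset.antisymm ?_ fun x hx => ⟨ha x hx, hb x hx⟩⟩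
    rintro x ⟨hax, hxb⟩
    by_contra hxS
    have hr := (SimpleGraph.reachable_iff_reflTransGen _ _).1 (h.preconnected ⟨a, haS⟩ ⟨b, hbS⟩)
    have key : ∀ y : S, Relation.ReflTransGen ((SimpleGraph.pathGraph t).induce S).Adj ⟨a, haS⟩ y →
        y.1 < x := by
      intro y hy
      induction hy with
      | refl => exact lt_of_le_of_ne hax fun e => hxS (e ▸ haS)
      | @tail y z _ hyz ih =>
        rw [SimpleGraph.comap_adj, SimpleGraph.pathGraph_adj] at hyz
        have hzx : (z : Fin t) ≠ x := fun e => hxS (e ▸ z.2)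
        have hzx' : ((z : Fin t) : ℕ) ≠ x := fun e => hzx (Fin.ext e)
        simp only [Fin.lt_def, Function.Embedding.subtype_apply] at *
        omega
    exact absurd (key _ hr) (not_lt.2 hxb)

/-- `R` is a subpaths-in-path (interval) representation of `G` in the path with `t` vertices: two
distinct vertices of `G` are adjacent if and only if their subpaths share a vertex. -/
def IsIntRep {n t : ℕ} (G : SimpleGraph (Fin n)) (R : Fin n → Subpath t) : Prop :=
  ∀ u v : Fin n, u ≠ v → (G.Adj u v ↔ ((R u).verts ∩ (R v).verts).Nonempty)

/-- A proper interval representation: no subpath is a proper subset of another one. -/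
def IsPintRep {n t : ℕ} (G : SimpleGraph (Fin n)) (R : Fin n → Subpath t) : Prop :=
  IsIntRep G R ∧ ∀ u v : Fin n, ¬ (R u).verts ⊂ (R v).verts

/-! ## The partial representation extension problems -/

/-- An instance: a graph `G` with `n` vertices, a path with `t` vertices, and for some of the
vertices of `G` (the pre-drawn ones) a prescribed subpath of the path. -/
structure Instance where
  n : ℕ
  t : ℕ
  G : SimpleGraph (Fin n)
  pre : Fin n → Option (Subpath t)

/-- The number of edges of the graph of an instance. -/
noncomputable def Instance.m (I : Instance) : ℕ := I.G.edgeSet.ncard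

/-- `R` extends the partial representation: every pre-drawn vertex keeps its subpath. -/
def Instance.Extends (I : Instance) (R : Fin I.n → Subpath I.t) : Prop :=
  ∀ (v : Fin I.n) (P : Subpath I.t), I.pre v = some P → R v = P

/-- The problem RepExt(INT, Fixed). -/
def RepExtIntFixed (I : Instance) : Prop :=
  ∃ R : Fin I.n → Subpath I.t, IsIntRep I.G R ∧ I.Extends R

/-- The problem RepExt(PINT, Fixed). -/
def RepExtPintFixed (I : Instance) : Prop :=
  ∃ R : Fin I.n → Subpath I.t, IsPintRep I.G R ∧ I.Extends R

/-! ## Input encoding and running time -/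

/-- `adj` lists, in any order, the neighbours of every vertex, each exactly once. -/
def Instance.IsAdjLists (I : Instance) (adj : Fin I.n → List (Fin I.n)) : Prop :=
  ∀ v : Fin I.n, (adj v).Nodup ∧ ∀ u : Fin I.n, u ∈ adj v ↔ I.G.Adj v u

/-- An array that holds the entries of a list, and zeros after them. -/
def cells (l : List ℕ) : ℕ → ℕ := fun i => l.getD i 0

/-- The initial state of the machine for an instance with adjacency lists `adj`.
`x₀ = n` and `x₁ = t`;
`A₁` is the concatenation of the adjacency lists of the vertices `0, …, n - 1`, and the list of `v`
occupies the positions `A₀[v], …, A₀[v + 1] - 1` in it;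
`A₂[v]` and `A₃[v]` are the positions in `{1, …, t}` of the left and the right end of the prescribed
subpath of `v` if `v` is pre-drawn, and `0` otherwise. Everything else is `0`. -/
def Instance.input (I : Instance) (adj : Fin I.n → List (Fin I.n)) : State where
  reg
    | 0 => I.n
    | 1 => I.t
    | _ => 0
  arr
    | 0 => cells ((List.range (I.n + 1)).map fun i => ((List.ofFn adj).take i).flatten.length)
    | 1 => cells ((List.ofFn adj).flatten.map fun u => (u : ℕ))
    | 2 => cells (List.ofFn fun v => (I.pre v).elim 0 fun P => (P.left : ℕ) + 1)
    | 3 => cells (List.ofFn fun v => (I.pre v).elim 0 fun P => (P.right : ℕ) + 1)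
    | _ => fun _ => 0

/-- On every instance `I` (for any order of its adjacency lists), program `p` halts after at most
`T I` steps, with `x₀ = 1` if the answer to the problem is yes, and with `x₀ = 0` if it is no. -/
def DecidesWithin (p : Prog) (problem : Instance → Prop) (T : Instance → ℕ) : Prop :=
  ∀ (I : Instance) (adj : Fin I.n → List (Fin I.n)), I.IsAdjLists adj →
    ∃ (k : ℕ) (s : State), Exec p (I.input adj) k s ∧ k ≤ T I ∧
      (problem I → s.reg 0 = 1) ∧ (¬ problem I → s.reg 0 = 0)

/-- The problem can be solved in time `O(T)`. -/
def SolvableInTimeO (problem : Instance → Prop) (T : Instance → ℕ) : Prop :=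
  ∃ (p : Prog) (C : ℕ), DecidesWithin p problem fun I => C * T I

/-- The problem is fixed-parameter tractable with respect to `param`: it can be solved in time
`f(param) * (size of the input)^c` for some computable function `f` and some constant `c`. -/
def IsFPT (problem : Instance → Prop) (param : Instance → ℕ) : Prop :=
  ∃ (p : Prog) (f : ℕ → ℕ) (c : ℕ), Computable f ∧
    DecidesWithin p problem fun I => f (param I) * (I.n + I.m + I.t + 1) ^ c

end RepExt

/-! Call two vertices twins if they have the same closed neighbourhood and the same prescription
(possibly none). In any representation, two vertices with the same subpath have the same closed
neighbourhood. So they are twins if both are free, and also if both are pre-drawn. Conversely, one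
subpath may serve a whole twin class: twins are adjacent, equal subpaths intersect, and equal sets
are not proper subsets of each other. Hence only one representative per twin class matters
(`Instance.Numbering.problem_iff`).

The path has at most (t² + t)/2 subpaths. If an extension exists, there are therefore at most that
many free representatives and at most t² + t representatives altogether
(`Instance.Numbering.bounds`); larger instances are rejected. Otherwise all assignments of codes l·t
+ r below t² to the F free representatives are tried. There are t^(2F) ≤ t^(t² + t) of them, each
checked in O(t⁴) steps against an adjacency matrix of the representatives, and t^(t² + t + 4) is
O(t^(2t²)) (`search_cost_le`).

The linear part is partition refinement. Starting from the prescriptions, every vertex in turn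
splits the classes by its closed neighbourhood, and time-stamped classes make this cost O(n + m)
(`SplitInv.step`, `SplitInv.next`, `run_split`). Multiplication and division are avoided by tables
and running sums. Correctness of the machine code rests on a cost-bounded Hoare calculus:
`Runs.eval` for loop-free code, `Runs.forLoop` for counted loops, and the frame rule `Exec.agree`.
-/

namespace RepExt

/-! ## Executions with bounded cost -/

/-- `p` started in `s` halts within `c` steps in a state that satisfies `Q`. -/
def Runs (p : Prog) (s : State) (c : ℕ) (Q : State → Prop) : Prop :=
  ∃ (k : ℕ) (s' : State), Exec p s k s' ∧ k ≤ c ∧ Q s'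

/-- The registers that a program may write. -/
def Prog.writesReg : Prog → ℕ → Bool
  | .skip, _ => false
  | .const d _, r => d == r
  | .add d _ _, r => d == r
  | .sub d _ _, r => d == r
  | .load d _ _, r => d == r
  | .store _ _ _, _ => false
  | .seq p q, r => p.writesReg r || q.writesReg r
  | .ite _ _ p q, r => p.writesReg r || q.writesReg r
  | .loop _ _ p, r => p.writesReg r

/-- The arrays that a program may write. -/
def Prog.writesArr : Prog → ℕ → Bool
  | .skip, _ => false
  | .const _ _, _ => false
  | .add _ _ _, _ => false
  | .sub _ _ _, _ => false
  | .load _ _ _, _ => false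
  | .store k _ _, r => k == r
  | .seq p q, r => p.writesArr r || q.writesArr r
  | .ite _ _ p q, r => p.writesArr r || q.writesArr r
  | .loop _ _ p, r => p.writesArr r

/-- The two states agree on all registers and arrays that `p` does not write. -/
structure Agree (p : Prog) (s s' : State) : Prop where
  reg : ∀ r, p.writesReg r = false → s'.reg r = s.reg r
  arr : ∀ a, p.writesArr a = false → s'.arr a = s.arr a

theorem Agree.refl (p : Prog) (s : State) : Agree p s s := ⟨fun _ _ => rfl, fun _ _ => rfl⟩

theorem Agree.trans {p : Prog} {s s' s'' : State} (h : Agree p s s') (h' : Agree p s' s'') :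
    Agree p s s'' :=
  ⟨fun r hr => (h'.reg r hr).trans (h.reg r hr), fun a ha => (h'.arr a ha).trans (h.arr a ha)⟩

theorem Agree.of_le {p q : Prog} {s s' : State} (h : Agree p s s')
    (hr : ∀ r, q.writesReg r = false → p.writesReg r = false)
    (ha : ∀ a, q.writesArr a = false → p.writesArr a = false) : Agree q s s' :=
  ⟨fun r h' => h.reg r (hr r h'), fun a h' => h.arr a (ha a h')⟩

/-- Frame rule. The write sets are Boolean functions of the program text, so for a concrete program
and register the side condition is settled by `rfl` or `decide`. -/
theorem Exec.agree {p : Prog} {s s' : State} {k : ℕ} (h : Exec p s k s') : Agree p s s' := by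
  induction h with
  | skip => exact .refl _ _
  | const d c s | add d a b s | sub d a b s | load d k a s =>
    refine ⟨fun r hr => ?_, fun _ _ => rfl⟩
    have hr : d ≠ r := by simpa [Prog.writesReg] using hr
    simp [State.setReg, hr.symm]
  | store k a b s =>
    refine ⟨fun _ _ => rfl, fun r hr => ?_⟩
    have hr : k ≠ r := by simpa [Prog.writesArr] using hr
    simp [State.setCell, hr.symm]
  | seq _ _ ih₁ ih₂ =>
    exact (ih₁.of_le (by simp +contextual [Prog.writesReg]) (by simp +contextual [Prog.writesArr])).trans
      (ih₂.of_le (by simp +contextual [Prog.writesReg]) (by simp +contextual [Prog.writesArr]))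
  | ite_true _ _ ih | ite_false _ _ ih =>
    exact ih.of_le (by simp +contextual [Prog.writesReg]) (by simp +contextual [Prog.writesArr])
  | loop_true _ _ _ ih₁ ih₂ => exact (ih₁.of_le (q := .loop _ _ _) (fun _ h => h) (fun _ h => h)).trans ih₂
  | loop_false => exact .refl _ _

theorem Runs.mono {p : Prog} {s : State} {c c' : ℕ} {Q Q' : State → Prop} (h : Runs p s c Q)
    (hc : c ≤ c') (hQ : ∀ s', Agree p s s' → Q s' → Q' s') : Runs p s c' Q' := by
  obtain ⟨k, s', he, hk, hq⟩ := h
  exact ⟨k, s', he, hk.trans hc, hQ s' he.agree hq⟩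

theorem Runs.seq {p q : Prog} {s : State} {c d : ℕ} {Q : State → Prop}
    (h : Runs p s c fun s' => Runs q s' d Q) : Runs (.seq p q) s (c + d) Q := by
  obtain ⟨k, s', he, hk, k', s'', he', hk', hq⟩ := h
  exact ⟨k + k', s'', .seq he he', Nat.add_le_add hk hk', hq⟩

/-! ### Programs without loops -/

/-- The effect of a program without loops. -/
def Prog.eval : Prog → State → State
  | .skip, s => s
  | .const d c, s => s.setReg d c
  | .add d a b, s => s.setReg d (s.reg a + s.reg b)
  | .sub d a b, s => s.setReg d (s.reg a - s.reg b)
  | .load d k a, s => s.setReg d (s.arr k (s.reg a))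
  | .store k a b, s => s.setCell k (s.reg a) (s.reg b)
  | .seq p q, s => q.eval (p.eval s)
  | .ite a b p q, s => if s.reg a < s.reg b then p.eval s else q.eval s
  | .loop _ _ _, s => s

/-- A bound for the number of steps of a program without loops. -/
def Prog.cost : Prog → ℕ
  | .seq p q => p.cost + q.cost
  | .ite _ _ p q => p.cost + q.cost + 1
  | _ => 1

/-- The program has no loops. -/
def Prog.loopFree : Prog → Bool
  | .seq p q => p.loopFree && q.loopFree
  | .ite _ _ p q => p.loopFree && q.loopFree
  | .loop _ _ _ => false
  | _ => true

/-- Without loops the final state is a computable term that `simp` can unfold. The cost charges both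
branches of a test, which makes the bound independent of the state. -/
theorem Runs.eval {p : Prog} (hp : p.loopFree = true) {s : State} {Q : State → Prop}
    (h : Q (p.eval s)) : Runs p s p.cost Q := by
  suffices H : ∀ (p : Prog), p.loopFree = true → ∀ s, ∃ k, Exec p s k (p.eval s) ∧ k ≤ p.cost by
    obtain ⟨k, he, hk⟩ := H p hp s
    exact ⟨k, _, he, hk, h⟩
  intro p
  induction p with
  | skip => exact fun _ s => ⟨1, .skip s, le_rfl⟩
  | const d c => exact fun _ s => ⟨1, .const d c s, le_rfl⟩
  | add d a b => exact fun _ s => ⟨1, .add d a b s, le_rfl⟩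
  | sub d a b => exact fun _ s => ⟨1, .sub d a b s, le_rfl⟩
  | load d k a => exact fun _ s => ⟨1, .load d k a s, le_rfl⟩
  | store k a b => exact fun _ s => ⟨1, .store k a b s, le_rfl⟩
  | seq p q ihp ihq =>
    intro h s
    simp only [Prog.loopFree, Bool.and_eq_true] at h
    obtain ⟨k, he, hk⟩ := ihp h.1 s
    obtain ⟨k', he', hk'⟩ := ihq h.2 (p.eval s)
    exact ⟨k + k', .seq he he', Nat.add_le_add hk hk'⟩
  | ite a b p q ihp ihq =>
    intro h s
    simp only [Prog.loopFree, Bool.and_eq_true] at h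
    by_cases hc : s.reg a < s.reg b
    · obtain ⟨k, he, hk⟩ := ihp h.1 s
      refine ⟨k + 1, ?_, by simp only [Prog.cost]; omega⟩
      simpa only [Prog.eval, if_pos hc] using Exec.ite_true hc he
    · obtain ⟨k, he, hk⟩ := ihq h.2 s
      refine ⟨k + 1, ?_, by simp only [Prog.cost]; omega⟩
      simpa only [Prog.eval, if_neg hc] using Exec.ite_false hc he
  | loop => simp [Prog.loopFree]

/-! ### Loops -/

/-- The invariant carries the iteration index, and `hcond` makes the guard equivalent to j < N. This
fixes the number of iterations, so termination and cost follow by induction on N - j₀. -/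
theorem Runs.loop {a b : ℕ} {p : Prog} {s : State} {j₀ N : ℕ} (c : ℕ → ℕ)
    (Inv : ℕ → State → Prop) (hj : j₀ ≤ N) (h₀ : Inv j₀ s)
    (hcond : ∀ j s', j ≤ N → Inv j s' → (s'.reg a < s'.reg b ↔ j < N))
    (step : ∀ j s', j₀ ≤ j → j < N → Inv j s' → Runs p s' (c j) (Inv (j + 1))) :
    Runs (.loop a b p) s (∑ j ∈ Finset.Ico j₀ N, (c j + 1) + 1) (Inv N) := by
  obtain ⟨d, rfl⟩ := Nat.exists_eq_add_of_le hj
  clear hj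
  induction d generalizing j₀ s with
  | zero =>
    refine ⟨1, s, .loop_false fun h => ?_, by simp, h₀⟩
    have := (hcond j₀ s le_rfl h₀).1 h
    omega
  | succ d ih =>
    obtain ⟨k, s₁, he, hk, h₁⟩ := step j₀ s le_rfl (by omega) h₀
    have e : j₀ + (d + 1) = j₀ + 1 + d := by omega
    rw [e] at hcond step ⊢
    obtain ⟨k', s₂, he', hk', h₂⟩ := ih h₁ hcond fun j s' hj => step j s' (by omega)
    refine ⟨k + k' + 1, s₂, .loop_true ((hcond j₀ s (by omega) h₀).2 (by omega)) he he', ?_, h₂⟩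
    rw [Finset.sum_eq_sum_Ico_succ_bot (by omega)]
    omega

/-- `while x_i < x_b do (p; x_i := x_i + x₂)`, where `x₂` is meant to hold `1`. -/
def forLoop (i b : ℕ) (p : Prog) : Prog := .loop i b (.seq p (.add i i 2))

theorem Runs.forLoop {i b : ℕ} {p : Prog} {s : State} {a N : ℕ} (c : ℕ → ℕ)
    (Inv : ℕ → State → Prop) (hi : s.reg i = a) (hb : s.reg b = N) (h2 : s.reg 2 = 1)
    (haN : a ≤ N) (hw : p.writesReg i = false ∧ p.writesReg b = false ∧ p.writesReg 2 = false ∧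
      i ≠ b ∧ i ≠ 2) (h₀ : Inv a s)
    (step : ∀ j s', a ≤ j → j < N → s'.reg i = j → Agree (forLoop i b p) s s' → Inv j s' →
      Runs p s' (c j) fun s'' => Inv (j + 1) (s''.setReg i (j + 1))) :
    Runs (forLoop i b p) s (∑ j ∈ Finset.Ico a N, (c j + 2) + 1) (Inv N) := by
  obtain ⟨wi, wb, w2, hib, hi2⟩ := hw
  have wb' : (RepExt.forLoop i b p).writesReg b = false := by
    simp [RepExt.forLoop, Prog.writesReg, wb, hib]
  have w2' : (RepExt.forLoop i b p).writesReg 2 = false := by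
    simp [RepExt.forLoop, Prog.writesReg, w2, hi2]
  refine (Runs.loop (a := i) (b := b) (fun j => c j + 1)
    (fun j s' => Inv j s' ∧ s'.reg i = j ∧ Agree (RepExt.forLoop i b p) s s') haN
    ⟨h₀, hi, .refl _ _⟩ ?_ ?_).mono (le_refl _) fun s' _ h => h.1
  · rintro j s' - ⟨-, h, hA⟩
    rw [h, hA.reg b wb', hb]
  · rintro j s' h₁ h₂ ⟨hInv, h, hA⟩
    refine Runs.seq ((step j s' h₁ h₂ h hA hInv).mono le_rfl fun s'' hA' hInv' => ?_)
    have e : s''.reg i + s''.reg 2 = j + 1 := by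
      rw [hA'.reg i wi, hA'.reg 2 w2, h, hA.reg 2 w2', h2]
    refine ⟨1, _, .add i i 2 s'', le_rfl, ?_⟩
    rw [e]
    refine ⟨hInv', by simp [State.setReg], hA.trans ⟨fun r hr => ?_, fun r hr => ?_⟩⟩
    · simp only [RepExt.forLoop, Prog.writesReg, Bool.or_eq_false_iff, beq_eq_false_iff_ne] at hr
      simp [State.setReg, hr.2.symm, hA'.reg r hr.1]
    · simp only [RepExt.forLoop, Prog.writesArr, Bool.or_false] at hr
      exact hA'.arr r hr

theorem Runs.forLoop_const {i b : ℕ} {p : Prog} {s : State} {a N : ℕ} (c : ℕ)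
    (Inv : ℕ → State → Prop) (hi : s.reg i = a) (hb : s.reg b = N) (h2 : s.reg 2 = 1)
    (haN : a ≤ N) (hw : p.writesReg i = false ∧ p.writesReg b = false ∧ p.writesReg 2 = false ∧
      i ≠ b ∧ i ≠ 2) (h₀ : Inv a s)
    (step : ∀ j s', a ≤ j → j < N → s'.reg i = j → Agree (RepExt.forLoop i b p) s s' → Inv j s' →
      Runs p s' c fun s'' => Inv (j + 1) (s''.setReg i (j + 1))) :
    Runs (RepExt.forLoop i b p) s ((N - a) * (c + 2) + 1) (Inv N) :=
  (Runs.forLoop (fun _ => c) Inv hi hb h2 haN hw h₀ step).mono (by simp) fun _ _ h => h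

/-- Sequential composition of a list of programs. -/
def block : List Prog → Prog
  | [] => .skip
  | [p] => p
  | p :: ps => .seq p (block ps)

open Prog

/-! ## The programs -/

/-- Tabulates the codes `c = l * t + r` of the pairs `(l, r)` with `l, r < t`: `A₄[l + 1] = l * t`,
`A₅[c] = l`, `A₆[c] = r`, and `x₄ = t * t`. -/
def tableProg : Prog :=
  block [.const 2 1, .const 3 0, .const 4 0, .const 6 0,
    forLoop 6 1 (block [.add 10 6 2, .store 4 10 4, .const 7 0,
      forLoop 7 1 (block [.store 5 4 6, .store 6 4 7, .add 4 4 2])]),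
    -- The row length x₁₄ = 2t² + 1 of the matrix exceeds every number of representatives that is
    -- not rejected. The first unused class name is x₅ = t² + 1, because t² is the class of the free
    -- vertices.
    .add 14 4 4, .add 14 14 2, .add 5 4 2]

/-- Initial classes `A₇` of the vertices: the code of the prescribed subpath, or `t * t`; `A₈` holds
the code, or `0`. -/
def labelProg : Prog :=
  block [.const 6 0, forLoop 6 0 (block [.load 10 2 6,
    -- Ends are stored shifted by one, so zero means free. The class t² differs from all codes,
    -- whereas the zero in A₈ later becomes the starting digit of the enumeration.
    .ite 10 2 (block [.store 7 6 4, .store 8 6 3])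
      (block [.load 11 4 10, .load 12 3 6, .add 11 11 12, .sub 11 11 2, .store 7 6 11,
        .store 8 6 11])])]

/-- Runs `body` for all pairs `(x₆, x₇)` of vertices that are equal or adjacent. -/
def closedLoop (body : Prog) : Prog :=
  block [.const 6 0, forLoop 6 0 (block [.add 7 6 3, body, .load 8 0 6, .add 9 6 2, .load 9 0 9,
    forLoop 8 9 (block [.load 7 1 8, body])])]

/-- Moves the vertex `x₇` into the part of its class that is split off for the pivot `x₆`. -/
def splitBody : Prog :=
  block [.load 10 7 7, .load 11 9 10, .add 12 6 2,
    -- A₉ holds the last pivot plus one, so the initial zeros count as older than every pivot and no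
    -- stamp is ever reset. A class not yet stamped gets a fresh name in A₁₀ for its moved part.
    .ite 11 12 (block [.store 9 10 12, .store 10 10 5, .add 5 5 2]) .skip,
    .load 13 10 10, .store 7 7 13]

/-- Makes the vertex `x₆` a representative if its class has none. -/
def selectBody : Prog :=
  block [.load 11 7 6, .load 12 11 11,
    .ite 12 2 (block [.store 11 11 2, .add 15 15 2, .add 16 16 14, .store 12 6 15, .store 13 6 16,
      .load 13 8 6, .store 14 15 13]) .skip]

/-- Selects a representative of every class not met before that has a vertex passing the test. -/
def selectProg (a b : ℕ) : Prog :=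
  block [.const 6 0, forLoop 6 0 (block [.load 10 2 6, .ite a b selectBody .skip])]

/-- Enters the pair `(x₆, x₇)` in the adjacency matrix `A₁₅`. -/
def matrixBody : Prog :=
  block [.load 10 13 6, .load 11 12 7, .add 10 10 11, .store 15 10 2]

/-- Sets `x₂₁` if the interval `[x₂₆, x₂₇]` is strictly included in `[x₂₈, x₂₉]`. -/
def properTest : Bool → Prog
  | true => .ite 26 28 .skip (.ite 29 27 .skip
      (.ite 28 26 (.const 21 1) (.ite 27 29 (.const 21 1) .skip)))
  | false => .skip

/-- Compares one entry of the matrix with the intervals that are assigned to its row and column. -/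
def entryTest (b : Bool) : Prog :=
  block [.load 25 14 23, .load 28 5 25, .load 29 6 25, .add 30 24 23, .load 30 15 30,
    .ite 29 26 (.const 31 0) (.ite 27 28 (.const 31 0) (.const 31 1)),
    .ite 31 30 (.const 21 1) (.ite 30 31 (.const 21 1) .skip), properTest b]

/-- Checks the assignment `A₁₄` of codes to the representatives. -/
def checkProg (b : Bool) : Prog :=
  block [.const 21 0, .const 24 0, .const 22 1,
    forLoop 22 18 (block [.add 24 24 14, .load 25 14 22, .load 26 5 25, .load 27 6 25, .const 23 1,
      forLoop 23 18 (entryTest b)])]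

/-- Increments the number with the digits `A₁₄[1], …, A₁₄[x₁₇]` in base `x₄`; `x₂₀` is the carry. -/
def incrProg : Prog :=
  block [.const 20 1, .const 22 1,
    forLoop 22 32 (block [.load 25 14 22, .add 25 25 20,
      .ite 25 4 (block [.store 14 22 25, .const 20 0]) (block [.store 14 22 3, .const 20 1])])]

/-- Tries all assignments of codes to the free representatives. -/
def searchProg (b : Bool) : Prog :=
  block [.add 18 15 2, .add 32 17 2, .const 20 0,
    -- The guard is the carry: the loop ends when the counter overflows. With no free digit the
    -- first increment overflows, so exactly one check is made.
    .loop 20 2 (block [checkProg b, .ite 21 2 (.const 19 1) .skip, incrProg])]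

/-- Rejects if there are too many representatives, and searches otherwise. -/
def decideProg (b : Bool) : Prog :=
  block [.const 19 0, .add 10 17 17, .add 11 4 1, .add 12 4 4,
    .ite 11 10 .skip (.ite 12 15 .skip (searchProg b)), .add 0 19 3]

/-- The whole algorithm; `b` tells whether the representation has to be proper. -/
def solver (b : Bool) : Prog :=
  block [tableProg, labelProg, closedLoop splitBody, .const 15 0, .const 16 0, selectProg 10 2,
    -- Free vertices are selected first, so F is the count reached here and the free representatives
    -- are numbered 1, …, F.
    .add 17 15 3, selectProg 3 10, closedLoop matrixBody, decideProg b]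

/-! ## Tables -/

theorem block_cons {p q : Prog} {ps : List Prog} : block (p :: q :: ps) = .seq p (block (q :: ps)) :=
  rfl

theorem block_singleton {p : Prog} : block [p] = p := rfl

/-- The effect of a loop-free prefix. -/
theorem Runs.eval_seq {p q : Prog} (hp : p.loopFree = true) {s : State} {c d : ℕ}
    {Q : State → Prop} (h : Runs q (p.eval s) c Q) (hd : p.cost + c ≤ d) : Runs (.seq p q) s d Q :=
  (Runs.seq (Runs.eval hp h)).mono hd fun _ _ h => h

theorem Runs.seq' {p q : Prog} {s : State} {c d e : ℕ} {Q Q' : State → Prop} (hp : Runs p s c Q')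
    (h : ∀ s', Agree p s s' → Q' s' → Runs q s' d Q) (he : c + d ≤ e) : Runs (.seq p q) s e Q :=
  (Runs.seq (hp.mono le_rfl h)).mono he fun _ _ h => h

/-- A nested count through all pairs (l, r) meets the codes in increasing order, which tabulates
quotient and remainder by t using additions only. -/
theorem run_tableProg (s : State) :
    Runs tableProg s (100 * (s.reg 1 * s.reg 1 + s.reg 1 + 1)) fun s' =>
      s'.reg 2 = 1 ∧ s'.reg 3 = 0 ∧ s'.reg 4 = s.reg 1 * s.reg 1 ∧
      s'.reg 14 = 2 * (s.reg 1 * s.reg 1) + 1 ∧ s'.reg 5 = s.reg 1 * s.reg 1 + 1 ∧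
      (∀ l < s.reg 1, s'.arr 4 (l + 1) = l * s.reg 1) ∧
      ∀ c < s.reg 1 * s.reg 1, s'.arr 5 c = c / s.reg 1 ∧ s'.arr 6 c = c % s.reg 1 := by
  generalize ht : s.reg 1 = t
  unfold tableProg
  rw [block_cons]; refine Runs.eval_seq rfl (c := 99 * (t * t + t + 1)) ?_ (by simp [Prog.cost]; omega)
  rw [block_cons]; refine Runs.eval_seq rfl (c := 98 * (t * t + t + 1)) ?_ (by simp [Prog.cost]; omega)
  rw [block_cons]; refine Runs.eval_seq rfl (c := 97 * (t * t + t + 1)) ?_ (by simp [Prog.cost]; omega)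
  rw [block_cons]; refine Runs.eval_seq rfl (c := 96 * (t * t + t + 1)) ?_ (by simp [Prog.cost]; omega)
  rw [block_cons]
  set s₁ := (const 6 0).eval ((const 4 0).eval ((const 3 0).eval ((const 2 1).eval s))) with hs₁
  refine Runs.seq' (c := (t - 0) * ((5 * t + 7) + 2) + 1) (d := 3) (Q' := fun s' => s'.reg 4 = t * t ∧
      (∀ l < t, s'.arr 4 (l + 1) = l * t) ∧
      ∀ c < t * t, s'.arr 5 c = c / t ∧ s'.arr 6 c = c % t) (Runs.forLoop_const _ (fun l s' => s'.reg 4 = l * t ∧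
      (∀ l' < l, s'.arr 4 (l' + 1) = l' * t) ∧
      ∀ c < l * t, s'.arr 5 c = c / t ∧ s'.arr 6 c = c % t) ?_ ?_ ?_ (by omega) (by decide) ?_ ?_) ?_ ?_
  · simp [s₁, Prog.eval, State.setReg]
  · simp [s₁, Prog.eval, State.setReg, ht]
  · simp [s₁, Prog.eval, State.setReg]
  · simp [s₁, Prog.eval, State.setReg]
  · rintro l s₂ - hl h6 hA ⟨h4, hm, hc⟩
    have h1 : s₂.reg 1 = t := by rw [hA.reg 1 rfl, hs₁]; simp [Prog.eval, State.setReg, ht]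
    have h2 : s₂.reg 2 = 1 := by rw [hA.reg 2 rfl, hs₁]; simp [Prog.eval, State.setReg]
    rw [block_cons]; refine Runs.eval_seq rfl (c := 5 * t + 6) ?_ (by simp [Prog.cost]; omega)
    rw [block_cons]; refine Runs.eval_seq rfl (c := 5 * t + 5) ?_ (by simp [Prog.cost]; omega)
    rw [block_cons]; refine Runs.eval_seq rfl (c := 5 * t + 4) ?_ (by simp [Prog.cost]; omega)
    rw [block_singleton]
    refine (Runs.forLoop_const (a := 0) (N := t) 3 (fun r s' => s'.reg 4 = l * t + r ∧
      ∀ c < l * t + r, s'.arr 5 c = c / t ∧ s'.arr 6 c = c % t) ?_ ?_ ?_ (by omega) (by decide) ?_ ?_).mono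
      ?_ ?_
    · simp [Prog.eval, State.setReg]
    · simp [Prog.eval, State.setReg, State.setCell, h1]
    · simp [Prog.eval, State.setReg, State.setCell, h2]
    · simpa [Prog.eval, State.setReg, State.setCell, h4] using hc
    · rintro r s₃ - hr h7 hA' ⟨h4', hc'⟩
      have h6' : s₃.reg 6 = l := by
        rw [hA'.reg 6 rfl]; simp [Prog.eval, State.setReg, State.setCell, h6]
      have h2' : s₃.reg 2 = 1 := by
        rw [hA'.reg 2 rfl]; simp [Prog.eval, State.setReg, State.setCell, h2]
      refine Runs.eval rfl ⟨?_, fun c hc => ?_⟩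
      · simp [block, Prog.eval, State.setReg, State.setCell, h4', h2']
        omega
      · by_cases e : c = l * t + r
        · subst e
          have e1 : (l * t + r) / t = l := by
            rw [mul_comm, Nat.mul_add_div (by omega), Nat.div_eq_of_lt hr, add_zero]
          have e2 : (l * t + r) % t = r := by
            rw [mul_comm, Nat.mul_add_mod, Nat.mod_eq_of_lt hr]
          simp [block, Prog.eval, State.setReg, State.setCell, h4', h6', h7, e1, e2]
        · have := hc' c (by omega)
          simpa [block, Prog.eval, State.setReg, State.setCell, h4', h6', h7, e] using this
    · simp; omega
    · rintro s₃ hA' ⟨h4', hc'⟩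
      refine ⟨?_, fun l' hl' => ?_, ?_⟩
      · simp [State.setReg, h4']; ring
      · have := hm l'
        simp only [State.setReg, hA'.arr 4 rfl]
        by_cases e : l' = l
        · subst e
          simp [Prog.eval, State.setReg, State.setCell, h6, h2, h4]
        · simpa [Prog.eval, State.setReg, State.setCell, h6, h2, h4, e] using this (by omega)
      · intro c hc
        exact hc' c (by rw [add_mul] at hc; omega)
  · rintro s₂ hA ⟨h4, hm, hc⟩
    have h2 : s₂.reg 2 = 1 := by rw [hA.reg 2 rfl, hs₁]; simp [Prog.eval, State.setReg]
    have h3 : s₂.reg 3 = 0 := by rw [hA.reg 3 rfl, hs₁]; simp [Prog.eval, State.setReg]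
    refine Runs.eval rfl ?_
    simp [block, Prog.eval, State.setReg, h4, h2, h3]
    exact ⟨by ring, hm, hc⟩
  · rw [Nat.sub_zero]; nlinarith

theorem run_labelProg (s : State) (T : ℕ) (h2 : s.reg 2 = 1) (h3 : s.reg 3 = 0) (h4 : s.reg 4 = T) :
    Runs labelProg s (20 * s.reg 0 + 20) fun s' =>
      ∀ v < s.reg 0,
        s'.arr 7 v = (if s.arr 2 v = 0 then T else s.arr 4 (s.arr 2 v) + s.arr 3 v - 1) ∧
        s'.arr 8 v = (if s.arr 2 v = 0 then 0 else s.arr 4 (s.arr 2 v) + s.arr 3 v - 1) := by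
  unfold labelProg
  rw [block_cons, block_singleton]
  refine Runs.eval_seq rfl (c := (s.reg 0 - 0) * (10 + 2) + 1) ?_ (by simp [Prog.cost]; omega)
  refine Runs.forLoop_const _ (fun n s' => ∀ v < n,
        s'.arr 7 v = (if s.arr 2 v = 0 then T else s.arr 4 (s.arr 2 v) + s.arr 3 v - 1) ∧
        s'.arr 8 v = (if s.arr 2 v = 0 then 0 else s.arr 4 (s.arr 2 v) + s.arr 3 v - 1)) ?_ ?_ ?_
        (by omega) (by decide) ?_ ?_
  · simp [Prog.eval, State.setReg]
  · simp [Prog.eval, State.setReg]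
  · simp [Prog.eval, State.setReg, h2]
  · simp
  · intro n s₁ _ hn h6 hA hv
    have e2 : s₁.reg 2 = 1 := by rw [hA.reg 2 rfl]; simp [Prog.eval, State.setReg, h2]
    have e3 : s₁.reg 3 = 0 := by rw [hA.reg 3 rfl]; simp [Prog.eval, State.setReg, h3]
    have e4 : s₁.reg 4 = T := by rw [hA.reg 4 rfl]; simp [Prog.eval, State.setReg, h4]
    have a2 : s₁.arr 2 = s.arr 2 := by rw [hA.arr 2 rfl]; simp [Prog.eval, State.setReg]
    have a3 : s₁.arr 3 = s.arr 3 := by rw [hA.arr 3 rfl]; simp [Prog.eval, State.setReg]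
    have a4 : s₁.arr 4 = s.arr 4 := by rw [hA.arr 4 rfl]; simp [Prog.eval, State.setReg]
    refine Runs.eval rfl fun v hvn => ?_
    have hv' := hv v
    by_cases h0 : s.arr 2 n = 0 <;> by_cases e : v = n
    · subst e
      simp [block, Prog.eval, State.setReg, State.setCell, h6, e2, e3, e4, a2, h0]
    · simpa [block, Prog.eval, State.setReg, State.setCell, h6, e2, e3, e4, a2, h0, e]
        using hv' (by omega)
    · subst e
      simp [block, Prog.eval, State.setReg, State.setCell, h6, e2, a2, a3, a4, h0]
    · simpa [block, Prog.eval, State.setReg, State.setCell, h6, e2, e3, e4, a2, a3, a4, h0, e]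
        using hv' (by omega)

/-! ## Loops over closed neighbourhoods -/

/-- The list argument of the invariant is the part of v :: nb v already treated. The invariant sees
only the arrays and x₅, so the loop control cannot disturb it. The degrees telescope to the last
offset A₀[n]. -/
theorem run_closedLoop {body : Prog} {s : State} {n : ℕ} {nb : ℕ → List ℕ}
    (hbody : body.loopFree = true)
    (hw : ∀ r ∈ [0, 2, 3, 6, 7, 8, 9], body.writesReg r = false)
    (hwa : ∀ a ∈ [0, 1], body.writesArr a = false)
    (Inv : ℕ → List ℕ → (ℕ → ℕ → ℕ) → ℕ → Prop)
    (h0 : s.reg 0 = n) (h2 : s.reg 2 = 1) (h3 : s.reg 3 = 0)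
    (hoff₀ : s.arr 0 0 = 0)
    (hoff : ∀ v < n, s.arr 0 (v + 1) = s.arr 0 v + (nb v).length)
    (hnb : ∀ v < n, ∀ j (hj : j < (nb v).length), s.arr 1 (s.arr 0 v + j) = (nb v)[j])
    (hInv : Inv 0 [] s.arr (s.reg 5))
    (step : ∀ v < n, ∀ l u r, v :: nb v = l ++ u :: r → ∀ s', Agree (closedLoop body) s s' →
      s'.reg 6 = v → s'.reg 7 = u → Inv v l s'.arr (s'.reg 5) →
      Inv v (l ++ [u]) (body.eval s').arr ((body.eval s').reg 5))
    (next : ∀ v < n, ∀ A f, Inv v (v :: nb v) A f → Inv (v + 1) [] A f) :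
    Runs (closedLoop body) s ((body.cost + 10) * (n + s.arr 0 n + 1)) fun s' =>
      Inv n [] s'.arr (s'.reg 5) := by
  have w0 := hw 0 (by simp)
  have w2 := hw 2 (by simp)
  have w3 := hw 3 (by simp)
  have w6 := hw 6 (by simp)
  have w7 := hw 7 (by simp)
  have w8 := hw 8 (by simp)
  have w9 := hw 9 (by simp)
  have wa0 := hwa 0 (by simp)
  have wa1 := hwa 1 (by simp)
  have hA₀ : ∀ {s'}, Agree (forLoop 6 0 (block [.add 7 6 3, body, .load 8 0 6, .add 9 6 2, .load 9 0 9,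
    forLoop 8 9 (block [.load 7 1 8, body])])) ((const 6 0).eval s) s' →
      Agree (closedLoop body) s s' := by
    intro s' h
    have h' : Agree (const 6 0) s ((const 6 0).eval s) := (Exec.const 6 0 s).agree
    refine (h'.of_le ?_ ?_).trans (h.of_le ?_ ?_) <;>
    · simp +contextual [closedLoop, forLoop, block, Prog.writesReg, Prog.writesArr]
  -- The summand is the exact shape produced by the nested loop rules; successive offsets differ by
  -- the list lengths, so the inner loops add up to an offset.
  have hsum : ∀ m ≤ n, ∑ v ∈ Finset.Ico 0 m, (body.cost + 5 + (((nb v).length - 0) * (1 + body.cost + 2) + 1) + 2) =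
      (body.cost + 8) * m + (body.cost + 3) * s.arr 0 m := by
    intro m hm
    induction m with
    | zero => simp [hoff₀]
    | succ m ih =>
      rw [Finset.sum_Ico_succ_top (by omega), ih (by omega), hoff m (by omega), Nat.sub_zero]
      ring
  unfold closedLoop
  rw [block_cons, block_singleton]
  refine Runs.eval_seq rfl ((Runs.forLoop (a := 0) (N := n)
    (fun v => body.cost + 5 + (((nb v).length - 0) * (1 + body.cost + 2) + 1))
    (fun v s' => Inv v [] s'.arr (s'.reg 5)) ?_ ?_ ?_ (by omega) ?_ ?_ ?_).mono le_rfl fun _ _ h => h) ?_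
  · simp [Prog.eval, State.setReg]
  · simp [Prog.eval, State.setReg, h0]
  · simp [Prog.eval, State.setReg, h2]
  · simp [block, forLoop, Prog.writesReg, w0, w2, w6]
  · simpa [Prog.eval, State.setReg] using hInv
  · intro v s₁ _ hv h6 hA hI
    have hA1 := hA₀ hA
    have nw : ∀ r ∈ [0, 2, 3], (closedLoop body).writesReg r = false := by
      simp [closedLoop, block, forLoop, Prog.writesReg, w0, w2, w3]
    have nwa : ∀ r ∈ [0, 1], (closedLoop body).writesArr r = false := by
      simp [closedLoop, block, forLoop, Prog.writesArr, wa0, wa1]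
    have e2 : s₁.reg 2 = 1 := by rw [hA1.reg 2 (nw 2 (by simp)), h2]
    have e3 : s₁.reg 3 = 0 := by rw [hA1.reg 3 (nw 3 (by simp)), h3]
    rw [block_cons]
    refine Runs.eval_seq rfl (c := body.cost + 4 + (((nb v).length - 0) * (1 + body.cost + 2) + 1)) ?_
      (by simp [Prog.cost]; omega)
    set s₂ := (Prog.add 7 6 3).eval s₁ with hs₂
    have hA2 : Agree (closedLoop body) s s₂ :=
      hA1.trans (((Exec.add 7 6 3 s₁).agree).of_le
        (by simp +contextual [closedLoop, forLoop, block, Prog.writesReg])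
        (by simp +contextual [closedLoop, forLoop, block, Prog.writesArr]))
    have hI2 : Inv v ([] ++ [v]) (body.eval s₂).arr ((body.eval s₂).reg 5) :=
      step v hv [] v (nb v) rfl s₂ hA2 (by simp [hs₂, Prog.eval, State.setReg, h6])
        (by simp [hs₂, Prog.eval, State.setReg, h6, e3])
        (by simpa [hs₂, Prog.eval, State.setReg] using hI)
    rw [block_cons]
    refine Runs.seq' (c := body.cost) (d := 4 + (((nb v).length - 0) * (1 + body.cost + 2) + 1)) (Q' := fun s' =>
      Inv v [v] s'.arr (s'.reg 5)) (Runs.eval hbody hI2) ?_ (by omega)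
    intro s₃ hA' hI3
    have hA3 : Agree (closedLoop body) s s₃ := hA2.trans (hA'.of_le
        (by simp +contextual [closedLoop, forLoop, block, Prog.writesReg])
        (by simp +contextual [closedLoop, forLoop, block, Prog.writesArr]))
    have f6 : s₃.reg 6 = v := by rw [hA'.reg 6 w6]; simp [hs₂, Prog.eval, State.setReg, h6]
    have f2 : s₃.reg 2 = 1 := by rw [hA3.reg 2 (nw 2 (by simp)), h2]
    have g0 : s₃.arr 0 = s.arr 0 := hA3.arr 0 (nwa 0 (by simp))
    rw [block_cons]; refine Runs.eval_seq rfl (c := 3 + (((nb v).length - 0) * (1 + body.cost + 2) + 1)) ?_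
      (by simp [Prog.cost]; omega)
    rw [block_cons]; refine Runs.eval_seq rfl (c := 2 + (((nb v).length - 0) * (1 + body.cost + 2) + 1)) ?_
      (by simp [Prog.cost]; omega)
    rw [block_cons]; refine Runs.eval_seq rfl (c := 1 + (((nb v).length - 0) * (1 + body.cost + 2) + 1)) ?_
      (by simp [Prog.cost]; omega)
    rw [block_singleton]
    set s₄ := (load 9 0 9).eval ((Prog.add 9 6 2).eval ((load 8 0 6).eval s₃)) with hs₄
    have hA4 : Agree (closedLoop body) s s₄ := by
      refine hA3.trans ⟨fun r hr => ?_, fun _ _ => rfl⟩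
      simp only [closedLoop, forLoop, block, Prog.writesReg, Bool.or_eq_false_iff, beq_eq_false_iff_ne] at hr
      simp [hs₄, Prog.eval, State.setReg, Function.update_apply]
      grind
    refine (Runs.forLoop_const (a := s.arr 0 v) (N := s.arr 0 (v + 1)) (1 + body.cost)
      (fun e s' => Inv v (v :: (nb v).take (e - s.arr 0 v)) s'.arr (s'.reg 5))
      ?_ ?_ ?_ ?_ ?_ ?_ ?_).mono ?_ ?_
    · simp [hs₄, Prog.eval, State.setReg, f6, g0]
    · simp [hs₄, Prog.eval, State.setReg, f6, f2, g0]
    · simp [hs₄, Prog.eval, State.setReg, f2]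
    · rw [hoff v hv]; omega
    · simp [block, Prog.writesReg, w8, w9, w2]
    · simpa [hs₄, Prog.eval, State.setReg] using hI3
    · intro e s₅ he₁ he₂ h8 hA' hI5
      obtain ⟨j, rfl⟩ := Nat.exists_eq_add_of_le he₁
      have hj : j < (nb v).length := by rw [hoff v hv] at he₂; omega
      rw [Nat.add_sub_cancel_left] at hI5
      have hA5 : Agree (closedLoop body) s s₅ := hA4.trans (hA'.of_le
        (by simp +contextual [closedLoop, forLoop, block, Prog.writesReg])
        (by simp +contextual [closedLoop, forLoop, block, Prog.writesArr]))
      have k6 : s₅.reg 6 = v := by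
        rw [hA'.reg 6 (by simp [block, forLoop, Prog.writesReg, w6]), hs₄]
        simp [Prog.eval, State.setReg, f6]
      have a1 : s₅.arr 1 = s.arr 1 := hA5.arr 1 (nwa 1 (by simp))
      rw [block_cons, block_singleton]
      refine Runs.eval_seq (c := body.cost) rfl ?_ le_rfl
      have := step v hv (v :: (nb v).take j) (nb v)[j] ((nb v).drop (j + 1)) (by simp)
        ((load 7 1 8).eval s₅) (hA5.trans (((Exec.load 7 1 8 s₅).agree).of_le
        (by simp +contextual [closedLoop, forLoop, block, Prog.writesReg])
        (by simp +contextual [closedLoop, forLoop, block, Prog.writesArr])))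
        (by simp [Prog.eval, State.setReg, k6])
        (by simp [Prog.eval, State.setReg, h8, a1, hnb v hv j hj])
        (by simpa [Prog.eval, State.setReg] using hI5)
      refine Runs.eval hbody ?_
      rw [show s.arr 0 v + j + 1 - s.arr 0 v = j + 1 by omega]
      simpa [State.setReg] using this
    · rw [hoff v hv, Nat.add_sub_cancel_left, Nat.sub_zero]; omega
    · intro s₅ _ hI5
      rw [hoff v hv, Nat.add_sub_cancel_left, List.take_length] at hI5
      simpa [State.setReg] using next v hv _ _ hI5
  · rw [hsum n le_rfl]
    simp only [Prog.cost]
    nlinarith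

/-! ## Partition refinement -/

/-- `u` and `w` have the same label, and are in the closed neighbourhoods of the same vertices below
`v`. -/
def SameClass (lab : ℕ → ℕ) (nb : ℕ → List ℕ) (v u w : ℕ) : Prop :=
  lab u = lab w ∧ ∀ v' < v, (u ∈ v' :: nb v' ↔ w ∈ v' :: nb v')

theorem sameClass_succ {lab : ℕ → ℕ} {nb : ℕ → List ℕ} {v u w : ℕ} :
    SameClass lab nb (v + 1) u w ↔ SameClass lab nb v u w ∧ (u ∈ v :: nb v ↔ w ∈ v :: nb v) := by
  simp only [SameClass, Nat.lt_succ_iff_lt_or_eq]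
  constructor
  · exact fun h => ⟨⟨h.1, fun v' hv' => h.2 v' (.inl hv')⟩, h.2 v (.inr rfl)⟩
  · rintro ⟨⟨h₁, h₂⟩, h₃⟩
    refine ⟨h₁, ?_⟩
    rintro v' (hv' | rfl)
    · exact h₂ v' hv'
    · exact h₃

/-- The state of the refinement while the pivot `v` is processed; `l` lists the vertices that have
been moved. -/
def SplitInv (n : ℕ) (lab : ℕ → ℕ) (nb : ℕ → List ℕ) (v : ℕ) (l : List ℕ) (A : ℕ → ℕ → ℕ) (f : ℕ) :
    Prop :=
  ∃ (cls : ℕ → ℕ) (f₀ : ℕ), (∀ u < n, ∀ w < n, (cls u = cls w ↔ SameClass lab nb v u w)) ∧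
    (∀ u < n, cls u < f₀) ∧ f₀ ≤ f ∧ (∀ u < n, u ∉ l → A 7 u = cls u) ∧
    (∀ u < n, u ∈ l → A 9 (cls u) = v + 1 ∧ A 7 u = A 10 (cls u)) ∧ (∀ c, A 9 c ≤ v + 1) ∧
    (∀ c, A 9 c = v + 1 → f₀ ≤ A 10 c ∧ A 10 c < f) ∧
    ∀ c c', A 9 c = v + 1 → A 9 c' = v + 1 → A 10 c = A 10 c' → c = c'

/-- Unmoved vertices keep names below f₀ and moved ones have names from f₀ on, so the two kinds are
separated. Among moved vertices the new name determines the old class, by injectivity of A₁₀ on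
stamped classes. For the next pivot no class is stamped yet, since all stamps are at most v + 1. -/
theorem SplitInv.next {n : ℕ} {lab : ℕ → ℕ} {nb : ℕ → List ℕ} {v : ℕ} {A : ℕ → ℕ → ℕ} {f : ℕ}
    (h : SplitInv n lab nb v (v :: nb v) A f) : SplitInv n lab nb (v + 1) [] A f := by
  obtain ⟨cls, f₀, h₁, h₂, h₃, h₄, h₅, h₆, h₇, h₈⟩ := h
  refine ⟨A 7, f, fun u hu w hw => ?_, fun u hu => ?_, le_rfl, fun _ _ _ => rfl, by simp,
    fun c => (h₆ c).trans (by omega), fun c hc => ?_, fun c _ hc => ?_⟩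
  · rw [sameClass_succ, ← h₁ u hu w hw]
    by_cases hul : u ∈ v :: nb v <;> by_cases hwl : w ∈ v :: nb v
    · have hu' := h₅ u hu hul
      have hw' := h₅ w hw hwl
      rw [hu'.2, hw'.2]
      constructor
      · exact fun e => ⟨h₈ _ _ hu'.1 hw'.1 e, iff_of_true hul hwl⟩
      · exact fun e => by rw [e.1]
    · have hu' := h₅ u hu hul
      have := h₇ _ hu'.1
      have := h₂ w hw
      rw [hu'.2, h₄ w hw hwl]
      constructor
      · intro e; omega
      · exact fun e => absurd (e.2.1 hul) hwl
    · have hw' := h₅ w hw hwl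
      have := h₇ _ hw'.1
      have := h₂ u hu
      rw [hw'.2, h₄ u hu hul]
      constructor
      · intro e; omega
      · exact fun e => absurd (e.2.2 hwl) hul
    · rw [h₄ u hu hul, h₄ w hw hwl]
      exact ⟨fun e => ⟨e, iff_of_false hul hwl⟩, fun e => e.1⟩
  · by_cases hul : u ∈ v :: nb v
    · obtain ⟨ha, hb⟩ := h₅ u hu hul
      rw [hb]; exact (h₇ _ ha).2
    · rw [h₄ u hu hul]; exact (h₂ u hu).trans_le h₃
  · have := h₆ c; omega
  · have := h₆ c; omega

/-- As u has not been moved, A₇[u] is still its old class. Either that class is unstamped and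
receives the fresh name x₅, or its part split off exists already and u joins it. -/
theorem SplitInv.step {n : ℕ} {lab : ℕ → ℕ} {nb : ℕ → List ℕ} {v : ℕ} {l : List ℕ} {u : ℕ}
    {s : State} (h2 : s.reg 2 = 1) (h6 : s.reg 6 = v) (h7 : s.reg 7 = u)
    (hu : u < n) (hul : u ∉ l) (h : SplitInv n lab nb v l s.arr (s.reg 5)) :
    SplitInv n lab nb v (l ++ [u]) (splitBody.eval s).arr ((splitBody.eval s).reg 5) := by
  obtain ⟨cls, f₀, h₁, h₂, h₃, h₄, h₅, h₆, h₇, h₈⟩ := h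
  have hc := h₄ u hu hul
  have hcf := h₂ u hu
  by_cases hm : s.arr 9 (cls u) < v + 1
  · have E7 : (splitBody.eval s).arr 7 = Function.update (s.arr 7) u (s.reg 5) := by
      simp [splitBody, block, Prog.eval, State.setReg, State.setCell, h2, h6, h7, hc, hm]
    have E9 : (splitBody.eval s).arr 9 = Function.update (s.arr 9) (cls u) (v + 1) := by
      simp [splitBody, block, Prog.eval, State.setReg, State.setCell, h2, h6, h7, hc, hm]
    have E10 : (splitBody.eval s).arr 10 = Function.update (s.arr 10) (cls u) (s.reg 5) := by
      simp [splitBody, block, Prog.eval, State.setReg, State.setCell, h2, h6, h7, hc, hm]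
    have E5 : (splitBody.eval s).reg 5 = s.reg 5 + 1 := by
      simp [splitBody, block, Prog.eval, State.setReg, State.setCell, h2, h6, h7, hc, hm]
    have hm' := hm.ne
    refine ⟨cls, f₀, h₁, h₂, by omega, ?_, ?_, ?_, ?_, ?_⟩ <;> simp only [E9, E7, E10, E5,
      Function.update_apply, List.mem_append, List.mem_singleton]
    · grind
    · intro w hw hwl
      by_cases e : w = u
      · subst e; simp
      · have hwl' : w ∈ l := by tauto
        obtain ⟨ha, hb⟩ := h₅ w hw hwl'
        -- The class of w is stamped and that of u is not, so stamping the latter leaves the data of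
        -- w alone.
        have : cls w ≠ cls u := fun e => hm' (e ▸ ha)
        simp [e, this, ha, hb]
    · intro c; split_ifs
      · exact le_rfl
      · exact h₆ c
    · intro c hc
      split_ifs with e
      · omega
      · rw [if_neg e] at hc
        have := h₇ c hc
        omega
    · intro c c' hc hc' e
      split_ifs at hc hc' e with i j j
      · rw [i, j]
      · have := h₇ c' hc'; omega
      · have := h₇ c hc; omega
      · exact h₈ c c' hc hc' e
  · have hm' : s.arr 9 (cls u) = v + 1 := by have := h₆ (cls u); omega
    have E7 : (splitBody.eval s).arr 7 = Function.update (s.arr 7) u (s.arr 10 (cls u)) := by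
      simp [splitBody, block, Prog.eval, State.setReg, State.setCell, h2, h6, h7, hc, hm]
    have E9 : (splitBody.eval s).arr 9 = s.arr 9 := by
      simp [splitBody, block, Prog.eval, State.setReg, State.setCell, h2, h6, h7, hc, hm]
    have E10 : (splitBody.eval s).arr 10 = s.arr 10 := by
      simp [splitBody, block, Prog.eval, State.setReg, State.setCell, h2, h6, h7, hc, hm]
    have E5 : (splitBody.eval s).reg 5 = s.reg 5 := by
      simp [splitBody, block, Prog.eval, State.setReg, State.setCell, h2, h6, h7, hc, hm]
    refine ⟨cls, f₀, h₁, h₂, by omega, ?_, ?_, ?_, ?_, ?_⟩ <;> simp only [E9, E7, E10, E5,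
      Function.update_apply, List.mem_append, List.mem_singleton]
    · grind
    · intro w hw hwl
      by_cases e : w = u
      · subst e; simp [hm']
      · simpa [e] using h₅ w hw (by tauto)
    · exact h₆
    · exact h₇
    · exact h₈

/-- The data of the adjacency lists that a state holds. -/
structure HoldsGraph (n : ℕ) (nb : ℕ → List ℕ) (s : State) : Prop where
  reg0 : s.reg 0 = n
  off_zero : s.arr 0 0 = 0
  off_succ : ∀ v < n, s.arr 0 (v + 1) = s.arr 0 v + (nb v).length
  nbr : ∀ v < n, ∀ j (hj : j < (nb v).length), s.arr 1 (s.arr 0 v + j) = (nb v)[j]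
  lt : ∀ v < n, ∀ u ∈ nb v, u < n
  nodup : ∀ v < n, (v :: nb v).Nodup

theorem HoldsGraph.congr {n : ℕ} {nb : ℕ → List ℕ} {s s' : State} (h : HoldsGraph n nb s)
    (h0 : s'.reg 0 = s.reg 0) (a0 : s'.arr 0 = s.arr 0) (a1 : s'.arr 1 = s.arr 1) :
    HoldsGraph n nb s' :=
  ⟨h0.trans h.reg0, a0 ▸ h.off_zero, a0 ▸ h.off_succ, a0 ▸ a1 ▸ h.nbr, h.lt, h.nodup⟩

/-- The initial partition is by label. Zeroed stamps and an x₅ above all labels make the invariant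
hold before the first pivot. -/
theorem run_split {s : State} {n : ℕ} {nb : ℕ → List ℕ} {lab : ℕ → ℕ} (hG : HoldsGraph n nb s)
    (h2 : s.reg 2 = 1) (h3 : s.reg 3 = 0) (h7 : ∀ v < n, s.arr 7 v = lab v)
    (h5 : ∀ v < n, lab v < s.reg 5) (h9 : ∀ c, s.arr 9 c = 0) :
    Runs (closedLoop splitBody) s (30 * (n + s.arr 0 n + 1)) fun s' =>
      ∀ u < n, ∀ w < n, (s'.arr 7 u = s'.arr 7 w ↔ SameClass lab nb n u w) := by
  refine (run_closedLoop rfl (by decide) (by decide) (SplitInv n lab nb) hG.reg0 h2 h3 hG.off_zero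
    hG.off_succ hG.nbr ?_ ?_ ?_).mono ?_ ?_
  · refine ⟨lab, s.reg 5, ?_, h5, le_rfl, fun u hu _ => h7 u hu, by simp, by simp [h9], by simp [h9],
      by simp [h9]⟩
    simp [SameClass]
  · intro v hv l u r hl s' hA h6 h7 hI
    refine hI.step ((hA.reg 2 rfl).trans h2) h6 h7 ?_ ?_
    · have : u ∈ v :: nb v := by simp [hl]
      rcases List.mem_cons.1 this with rfl | h
      · exact hv
      · exact hG.lt v hv u h
    -- A closed neighbourhood is listed without repetition, so no vertex is moved twice for one
    -- pivot.
    · have := hG.nodup v hv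
      rw [hl, List.nodup_append] at this
      exact fun h => this.2.2 u h u (by simp) rfl
  · exact fun v _ A f h => h.next
  · simp only [splitBody, block, Prog.cost]; omega
  · rintro s' - ⟨cls, f₀, h₁, -, -, h₄, -⟩ u hu w hw
    rw [h₄ u hu (by simp), h₄ w hw (by simp), h₁ u hu w hw]

/-! ## The adjacency matrix -/

-- Cells may collide here: all non-representatives share number 0, and the representatives may be
-- too many for the row length. Collisions are excluded only in `allOk_iff`, after the rejection
-- tests and for nonzero numbers.
open Classical in
theorem run_matrix {s : State} {n : ℕ} {nb : ℕ → List ℕ} (hG : HoldsGraph n nb s)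
    (h2 : s.reg 2 = 1) (h3 : s.reg 3 = 0) (h15 : ∀ x, s.arr 15 x = 0) :
    Runs (closedLoop matrixBody) s (30 * (n + s.arr 0 n + 1)) fun s' =>
      ∀ x, s'.arr 15 x =
        if ∃ v < n, ∃ u ∈ v :: nb v, s.arr 13 v + s.arr 12 u = x then 1 else 0 := by
  refine (run_closedLoop rfl (by decide) (by decide) (fun v l A _ => ∀ x, A 15 x =
    if (∃ v' < v, ∃ u ∈ v' :: nb v', s.arr 13 v' + s.arr 12 u = x) ∨
      (∃ u ∈ l, s.arr 13 v + s.arr 12 u = x) then 1 else 0)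
    hG.reg0 h2 h3 hG.off_zero hG.off_succ hG.nbr ?_ ?_ ?_).mono ?_ ?_
  · simp [h15]
  · intro v hv l u r hl s' hA h6 h7 hI x
    have e2 : s'.reg 2 = 1 := (hA.reg 2 rfl).trans h2
    have e : (matrixBody.eval s').arr 15 x = if s.arr 13 v + s.arr 12 u = x then 1 else s'.arr 15 x := by
      simp [matrixBody, block, Prog.eval, State.setReg, State.setCell, h6, h7, e2, hA.arr 13 rfl,
        hA.arr 12 rfl, Function.update_apply, eq_comm]
    rw [e, hI x]
    by_cases hx : s.arr 13 v + s.arr 12 u = x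
    · rw [if_pos hx, if_pos (Or.inr ⟨u, by simp, hx⟩)]
    · rw [if_neg hx]
      congr 1
      simp only [List.mem_append, List.mem_singleton, or_and_right, exists_or, exists_eq_left, hx,
        or_false]
  · intro v hv A f h x
    rw [h x]
    congr 1
    simp only [List.not_mem_nil, false_and, exists_false, or_false, Nat.lt_succ_iff_lt_or_eq,
      or_and_right, exists_or, exists_eq_left]
  · simp only [matrixBody, block, Prog.cost]; omega
  · intro s' _ h x
    rw [h x]
    simp

/-! ## Representatives -/

/-- `A₁₂` numbers representatives of the classes `cls` with the numbers `1, …, k`; the classes of the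
vertices in `C` have one. `A₁₃` holds `S` times the number and `A₁₄` the labels of the
representatives. -/
structure SelInv (n : ℕ) (cls lab : ℕ → ℕ) (S : ℕ) (C : ℕ → Prop) (Φ : ℕ → ℕ → Prop) (k base : ℕ)
    (A : ℕ → ℕ → ℕ) : Prop where
  base_eq : base = k * S
  le : ∀ v, A 12 v ≤ k
  lt : ∀ v, A 12 v ≠ 0 → v < n
  surj : ∀ i, 1 ≤ i → i ≤ k → ∃ v, A 12 v = i
  cls_inj : ∀ u v, A 12 u ≠ 0 → A 12 v ≠ 0 → cls u = cls v → u = v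
  inj : ∀ u v, A 12 u ≠ 0 → A 12 u = A 12 v → u = v
  row : ∀ v, A 13 v = A 12 v * S
  label : ∀ v, A 12 v ≠ 0 → A 14 (A 12 v) = lab v
  seen : ∀ c, A 11 c ≠ 0 ↔ ∃ r, A 12 r ≠ 0 ∧ cls r = c
  cover : ∀ u < n, C u → ∃ r, A 12 r ≠ 0 ∧ cls r = cls u
  num : ∀ v, A 12 v ≠ 0 → Φ v (A 12 v)

/-- If the class of v is unmarked, v becomes its representative with the next number; if it is
marked, the existing representative covers v and nothing changes. `C` records which vertices must be
covered and `Φ` what is known about a representative and its number. -/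
theorem SelInv.step {n : ℕ} {cls lab : ℕ → ℕ} {S : ℕ} {C C' : ℕ → Prop} {Φ : ℕ → ℕ → Prop} {v : ℕ}
    {s : State} (h2 : s.reg 2 = 1) (h6 : s.reg 6 = v) (h14 : s.reg 14 = S) (h7 : s.arr 7 = cls)
    (h8 : s.arr 8 = lab) (hv : v < n) (hC : ∀ u, C' u → C u ∨ u = v)
    (hΦ : Φ v (s.reg 15 + 1))
    (h : SelInv n cls lab S C Φ (s.reg 15) (s.reg 16) s.arr) :
    SelInv n cls lab S C' Φ ((selectBody.eval s).reg 15) ((selectBody.eval s).reg 16)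
      (selectBody.eval s).arr ∧ s.reg 15 ≤ (selectBody.eval s).reg 15 := by
  obtain ⟨g1, g2, g3, g4, g5, g6, g7, g8, g9, g10, g11⟩ := h
  by_cases hm : s.arr 11 (cls v) < 1
  · have E12 : (selectBody.eval s).arr 12 = Function.update (s.arr 12) v (s.reg 15 + 1) := by
      simp [selectBody, block, Prog.eval, State.setReg, State.setCell, h2, h6, h7, hm]
    have E13 : (selectBody.eval s).arr 13 = Function.update (s.arr 13) v (s.reg 16 + S) := by
      simp [selectBody, block, Prog.eval, State.setReg, State.setCell, h2, h6, h7, h14, hm]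
    have E14 : (selectBody.eval s).arr 14 = Function.update (s.arr 14) (s.reg 15 + 1) (lab v) := by
      simp [selectBody, block, Prog.eval, State.setReg, State.setCell, h2, h6, h7, h8, hm]
    have E11 : (selectBody.eval s).arr 11 = Function.update (s.arr 11) (cls v) 1 := by
      simp [selectBody, block, Prog.eval, State.setReg, State.setCell, h2, h6, h7, hm]
    have E15 : (selectBody.eval s).reg 15 = s.reg 15 + 1 := by
      simp [selectBody, block, Prog.eval, State.setReg, State.setCell, h2, h6, h7, hm]
    have E16 : (selectBody.eval s).reg 16 = s.reg 16 + S := by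
      simp [selectBody, block, Prog.eval, State.setReg, State.setCell, h2, h6, h7, h14, hm]
    have hnew : ∀ r, s.arr 12 r ≠ 0 → cls r ≠ cls v := fun r hr e =>
      (g9 (cls v)).2 ⟨r, hr, e⟩ (by omega)
    have hv0 : s.arr 12 v = 0 := by
      by_contra h0
      exact hnew v h0 rfl
    have upd : ∀ u, Function.update (s.arr 12) v (s.reg 15 + 1) u =
      if u = v then s.reg 15 + 1 else s.arr 12 u := fun u => Function.update_apply ..
    refine ⟨⟨?_, ?_, ?_, ?_, ?_, ?_, ?_, ?_, ?_, ?_, ?_⟩, by omega⟩ <;>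
      simp only [E12, E13, E14, E11, E15, E16, upd]
    · rw [g1]; ring
    · intro u; have := g2 u; split_ifs <;> omega
    · intro u hu; split_ifs at hu with e
      · omega
      · exact g3 u hu
    · intro i h1 hi
      rcases Nat.lt_or_ge (s.reg 15) i with hi' | hi'
      · exact ⟨v, by simp; omega⟩
      · obtain ⟨u, hu⟩ := g4 i h1 hi'
        have : u ≠ v := by rintro rfl; omega
        exact ⟨u, by simp [this, hu]⟩
    · intro u w hu hw e
      split_ifs at hu hw with i j j
      · rw [i, j]
      · exact absurd (i ▸ e.symm) (hnew w hw)
      · exact absurd (j ▸ e) (hnew u hu)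
      · exact g5 u w hu hw e
    · intro u w hu e
      have := g2 u
      have := g2 w
      split_ifs at hu e with i j j
      · rw [i, j]
      · omega
      · omega
      · exact g6 u w hu e
    · intro u
      rw [Function.update_apply]
      split_ifs with i
      · rw [g1]; ring
      · exact g7 u
    · intro u hu
      rw [Function.update_apply]
      have := g2 u
      split_ifs at hu ⊢ with i j j
      · rw [i]
      · omega
      · omega
      · exact g8 u hu
    · intro c
      rw [Function.update_apply]
      constructor
      · intro hc
        split_ifs at hc with i
        · exact ⟨v, by simp, i.symm⟩
        · obtain ⟨r, hr, hrc⟩ := (g9 c).1 hc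
          have : r ≠ v := by rintro rfl; exact hr hv0
          exact ⟨r, by simp [this, hr], hrc⟩
      · rintro ⟨r, hr, hrc⟩
        split_ifs with i
        · omega
        · have : r ≠ v := by rintro rfl; exact i hrc.symm
          rw [if_neg this] at hr
          exact (g9 c).2 ⟨r, hr, hrc⟩
    · intro u hu hu'
      rcases hC u hu' with h | rfl
      · obtain ⟨r, hr, hrc⟩ := g10 u hu h
        have : r ≠ v := by rintro rfl; exact hr hv0
        exact ⟨r, by simp [this, hr], hrc⟩
      · exact ⟨u, by simp, rfl⟩
    · intro u hu
      split_ifs at hu ⊢ with i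
      · exact i ▸ hΦ
      · exact g11 u hu
  · have E : (selectBody.eval s).arr = s.arr ∧ (selectBody.eval s).reg 15 = s.reg 15 ∧
        (selectBody.eval s).reg 16 = s.reg 16 := by
      simp [selectBody, block, Prog.eval, State.setReg, h2, h6, h7, hm]
    rw [E.1, E.2.1, E.2.2]
    refine ⟨⟨g1, g2, g3, g4, g5, g6, g7, g8, g9, fun u hu hu' => ?_, g11⟩, le_rfl⟩
    rcases hC u hu' with h | rfl
    · exact g10 u hu h
    · exact (g9 _).1 (by omega)

/-- Stated for an abstract test and an arbitrary starting count, so that it applies to both passes.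
Numbers given in this pass exceed the starting x₁₅, which is why `hΦ` is needed only for those. -/
theorem run_select {a b : ℕ} {P : ℕ → Prop} {s : State} {n : ℕ} {cls lab : ℕ → ℕ} {S : ℕ}
    {C : ℕ → Prop} {Φ : ℕ → ℕ → Prop}
    (h0 : s.reg 0 = n) (h2 : s.reg 2 = 1) (h3 : s.reg 3 = 0) (h14 : s.reg 14 = S)
    (h7 : s.arr 7 = cls) (h8 : s.arr 8 = lab)
    (hab : ∀ s' : State, s'.reg 2 = 1 → s'.reg 3 = 0 → ∀ v < n, s'.reg 10 = s.arr 2 v →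
      (s'.reg a < s'.reg b ↔ P v))
    (hΦ : ∀ v < n, P v → ∀ i, s.reg 15 < i → Φ v i)
    (h : SelInv n cls lab S C Φ (s.reg 15) (s.reg 16) s.arr) :
    Runs (selectProg a b) s (30 * (n + 1)) fun s' =>
      SelInv n cls lab S (fun v => C v ∨ v < n ∧ P v) Φ (s'.reg 15) (s'.reg 16) s'.arr ∧
        s.reg 15 ≤ s'.reg 15 := by
  unfold selectProg
  rw [block_cons, block_singleton]
  refine Runs.eval_seq rfl (Runs.forLoop_const (a := 0) (N := n) 14 (fun m s' =>
    SelInv n cls lab S (fun v => C v ∨ v < m ∧ P v) Φ (s'.reg 15) (s'.reg 16) s'.arr ∧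
        s.reg 15 ≤ s'.reg 15) ?_ ?_ ?_ (by omega) ⟨rfl, rfl, rfl, by decide⟩ ?_ ?_) ?_
  · simp [Prog.eval, State.setReg]
  · simp [Prog.eval, State.setReg, h0]
  · simp [Prog.eval, State.setReg, h2]
  · simpa [Prog.eval, State.setReg] using h
  · rintro v s₁ - hv h6 hA ⟨hI, hk⟩
    have e2 : s₁.reg 2 = 1 := by rw [hA.reg 2 rfl]; simp [Prog.eval, State.setReg, h2]
    have e3 : s₁.reg 3 = 0 := by rw [hA.reg 3 rfl]; simp [Prog.eval, State.setReg, h3]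
    have e14 : s₁.reg 14 = S := by rw [hA.reg 14 rfl]; simp [Prog.eval, State.setReg, h14]
    have a2 : s₁.arr 2 = s.arr 2 := by rw [hA.arr 2 rfl]; simp [Prog.eval, State.setReg]
    have a7 : s₁.arr 7 = cls := by rw [hA.arr 7 rfl]; simp [Prog.eval, State.setReg, h7]
    have a8 : s₁.arr 8 = lab := by rw [hA.arr 8 rfl]; simp [Prog.eval, State.setReg, h8]
    rw [block_cons, block_singleton]
    refine Runs.eval_seq (c := 13) rfl (Runs.eval rfl ?_) le_rfl
    set s₂ := (load 10 2 6).eval s₁ with hs₂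
    have hc := hab s₂ (by simp [hs₂, Prog.eval, State.setReg, e2])
      (by simp [hs₂, Prog.eval, State.setReg, e3]) v hv
      (by simp [hs₂, Prog.eval, State.setReg, h6, a2])
    have hI₂ : SelInv n cls lab S (fun u => C u ∨ u < v ∧ P u) Φ (s₂.reg 15) (s₂.reg 16) s₂.arr := by
      simpa [hs₂, Prog.eval, State.setReg] using hI
    have hk₂ : s.reg 15 ≤ s₂.reg 15 := by simpa [hs₂, Prog.eval, State.setReg] using hk
    rw [Prog.eval]
    by_cases hP : P v
    · rw [if_pos (hc.2 hP)]
      have := hI₂.step (s := s₂) (C' := fun u => C u ∨ u < v + 1 ∧ P u)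
        e2 h6 e14 a7 a8 hv
        (by rintro u (h | ⟨h₁, h₂⟩)
            · exact .inl (.inl h)
            · rcases Nat.lt_succ_iff_lt_or_eq.1 h₁ with h | h
              · exact .inl (.inr ⟨h, h₂⟩)
              · exact .inr h)
        (hΦ v hv hP _ (by omega))
      have hr : ∀ (s' : State) (r : ℕ), r ≠ 6 → (s'.setReg 6 (v + 1)).reg r = s'.reg r :=
        fun s' r hr => by simp [State.setReg, hr]
      rw [hr _ 15 (by decide), hr _ 16 (by decide)]
      have ha : ∀ s' : State, (s'.setReg 6 (v + 1)).arr = s'.arr := fun _ => rfl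
      rw [ha]
      generalize selectBody.eval s₂ = s₃ at this ⊢
      exact ⟨this.1, hk₂.trans this.2⟩
    · rw [if_neg (fun h => hP (hc.1 h))]
      have e : (fun u => C u ∨ u < v + 1 ∧ P u) = fun u => C u ∨ u < v ∧ P u := by
        funext u
        rw [Nat.lt_succ_iff_lt_or_eq]
        by_cases huv : u = v
        · subst huv; simp [hP]
        · simp [huv]
      simp only [State.setReg, Prog.eval, e]
      simpa using And.intro hI₂ hk₂
  · simp only [Prog.cost]; omega

/-! ## Checking an assignment -/

/-- The intervals with the codes `c` and `d` intersect if and only if `adj` holds, and, if `b` is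
true, the first one is not strictly included in the second one. -/
def EntryOk (b : Bool) (t : ℕ) (adj : Prop) (c d : ℕ) : Prop :=
  (adj ↔ c / t ≤ d % t ∧ d / t ≤ c % t) ∧
    (b = true → ¬ (d / t ≤ c / t ∧ c % t ≤ d % t ∧ (d / t < c / t ∨ c % t < d % t)))

theorem eval_entryTest (b : Bool) {s : State} {t i j S : ℕ}
    (h23 : s.reg 23 = j) (h24 : s.reg 24 = i * S) (h26 : s.reg 26 = s.arr 14 i / t)
    (h27 : s.reg 27 = s.arr 14 i % t)
    (h5 : s.arr 5 (s.arr 14 j) = s.arr 14 j / t) (h6 : s.arr 6 (s.arr 14 j) = s.arr 14 j % t)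
    (h15 : s.arr 15 (i * S + j) ≤ 1) :
    (EntryOk b t (s.arr 15 (i * S + j) = 1) (s.arr 14 i) (s.arr 14 j) →
      ((entryTest b).eval s).reg 21 = s.reg 21) ∧
    (¬ EntryOk b t (s.arr 15 (i * S + j) = 1) (s.arr 14 i) (s.arr 14 j) →
      ((entryTest b).eval s).reg 21 = 1) := by
  unfold EntryOk
  generalize s.arr 14 i = c at *
  have e : s.arr 15 (i * S + j) = 0 ∨ s.arr 15 (i * S + j) = 1 := by omega
  cases b <;> rcases e with e | e <;> by_cases g1 : s.arr 14 j % t < c / t <;>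
    by_cases g2 : c % t < s.arr 14 j / t <;>
    simp [entryTest, properTest, block, Prog.eval, State.setReg, h23, h24, h26, h27, h5, h6, e,
      g1, g2, not_lt.1] <;> (try split_ifs) <;> simp <;> omega

theorem cost_entryTest (b : Bool) : (entryTest b).cost ≤ 30 := by
  cases b <;> decide

theorem loopFree_entryTest (b : Bool) : (entryTest b).loopFree = true := by
  cases b <;> rfl

/-- All pairs of representatives pass the test for the assignment `d`. -/
def AllOk (b : Bool) (t k S : ℕ) (M d : ℕ → ℕ) : Prop :=
  ∀ i, 1 ≤ i → i ≤ k → ∀ j, 1 ≤ j → j ≤ k → EntryOk b t (M (i * S + j) = 1) (d i) (d j)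

/-- The flag x₂₁ is raised at the first failing pair and never lowered, so it is zero exactly when
all pairs tested so far pass. -/
theorem run_checkProg (b : Bool) {s : State} {t k S : ℕ} (h2 : s.reg 2 = 1) (h18 : s.reg 18 = k + 1)
    (h14 : s.reg 14 = S) (h5 : ∀ c < t * t, s.arr 5 c = c / t ∧ s.arr 6 c = c % t)
    (h15 : ∀ x, s.arr 15 x ≤ 1) (hd : ∀ i, 1 ≤ i → i ≤ k → s.arr 14 i < t * t) :
    Runs (checkProg b) s (60 * ((k + 1) * (k + 1))) fun s' =>
      (AllOk b t k S (s.arr 15) (s.arr 14) → s'.reg 21 = 0) ∧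
      (¬ AllOk b t k S (s.arr 15) (s.arr 14) → s'.reg 21 = 1) := by
  unfold checkProg
  rw [block_cons]; refine Runs.eval_seq rfl (c := k * (33 * k + 10) + 3) ?_ (by simp only [Prog.cost]; nlinarith)
  rw [block_cons]; refine Runs.eval_seq rfl (c := k * (33 * k + 10) + 2) ?_ (by simp only [Prog.cost]; nlinarith)
  rw [block_cons]; refine Runs.eval_seq rfl (c := k * (33 * k + 10) + 1) ?_ (by simp only [Prog.cost]; nlinarith)
  rw [block_singleton]
  obtain ⟨s₀, hs₀⟩ : ∃ s₀, s₀ = (const 22 1).eval ((const 24 0).eval ((const 21 0).eval s)) := ⟨_, rfl⟩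
  rw [← hs₀]
  have r₀ : ∀ r, r ≠ 21 → r ≠ 22 → r ≠ 24 → s₀.reg r = s.reg r := by
    intro r h1 h2 h3
    simp [hs₀, Prog.eval, State.setReg, h1, h2, h3]
  have a₀ : s₀.arr = s.arr := by rw [hs₀]; rfl
  have hw : (forLoop 23 18 (entryTest b)).writesReg 22 = false ∧ (forLoop 23 18 (entryTest b)).writesReg 18 = false
    ∧ (forLoop 23 18 (entryTest b)).writesReg 2 = false ∧ (forLoop 23 18 (entryTest b)).writesReg 24 = false ∧
    (forLoop 23 18 (entryTest b)).writesReg 14 = false := by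
    cases b <;> decide
  have hw' : (entryTest b).writesReg 22 = false ∧ (entryTest b).writesReg 18 = false ∧
    (entryTest b).writesReg 2 = false ∧ (entryTest b).writesReg 24 = false ∧ (entryTest b).writesReg 23 = false ∧
    (entryTest b).writesReg 26 = false ∧ (entryTest b).writesReg 27 = false := by
    cases b <;> decide
  have hwa : ∀ a, (forLoop 23 18 (entryTest b)).writesArr a = false := by
    cases b <;> exact fun a => rfl
  obtain ⟨M, hM⟩ : ∃ M, M = s.arr 15 := ⟨_, rfl⟩
  obtain ⟨D, hD⟩ : ∃ D, D = s.arr 14 := ⟨_, rfl⟩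
  -- The row offset is advanced at the start of each round, hence (m - 1)·S before round m.
  refine (Runs.forLoop_const (a := 1) (N := k + 1) (33 * k + 8) (fun m s' => s'.reg 24 = (m - 1) * S ∧
    (s'.reg 21 ≤ 1 ∧ (s'.reg 21 = 0 ↔
      ∀ i, 1 ≤ i → i < m → ∀ j, 1 ≤ j → j < k + 1 → EntryOk b t (M (i * S + j) = 1) (D i) (D j))))
    ?_ ?_ ?_ (by omega) ?_ ?_ ?_).mono ?_ ?_
  · simp [hs₀, Prog.eval, State.setReg]
  · rw [r₀ 18 (by decide) (by decide) (by decide), h18]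
  · rw [r₀ 2 (by decide) (by decide) (by decide), h2]
  · simp [block, Prog.writesReg, hw]
  · constructor
    · simp [hs₀, Prog.eval, State.setReg]
    · simp [hs₀, Prog.eval, State.setReg]
      intro i h1 h2
      omega
  · rintro i s₁ hi1 hik h22 hA ⟨h24, h21, hI⟩
    have a₁ : s₁.arr = s.arr := by
      rw [← a₀]; funext a
      exact hA.arr a (by simpa [forLoop, block, Prog.writesArr] using hwa a)
    have e14 : s₁.reg 14 = S := by
      rw [hA.reg 14 (by simpa [forLoop, block, Prog.writesReg] using hw.2.2.2.2), r₀ 14 (by decide) (by decide) (by decide), h14]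
    have e18 : s₁.reg 18 = k + 1 := by
      rw [hA.reg 18 (by simpa [forLoop, block, Prog.writesReg] using hw.2.1), r₀ 18 (by decide) (by decide) (by decide), h18]
    have e2 : s₁.reg 2 = 1 := by
      rw [hA.reg 2 (by simpa [forLoop, block, Prog.writesReg] using hw.2.2.1), r₀ 2 (by decide) (by decide) (by decide), h2]
    have hDi : D i < t * t := hD ▸ hd i hi1 (by omega)
    have hci := h5 (D i) hDi
    rw [block_cons]; refine Runs.eval_seq rfl (c := 33 * k + 7) ?_ (by simp [Prog.cost]; omega)
    rw [block_cons]; refine Runs.eval_seq rfl (c := 33 * k + 6) ?_ (by simp [Prog.cost]; omega)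
    rw [block_cons]; refine Runs.eval_seq rfl (c := 33 * k + 5) ?_ (by simp [Prog.cost]; omega)
    rw [block_cons]; refine Runs.eval_seq rfl (c := 33 * k + 4) ?_ (by simp [Prog.cost]; omega)
    rw [block_cons]; refine Runs.eval_seq rfl (c := 33 * k + 3) ?_ (by simp [Prog.cost]; omega)
    rw [block_singleton]
    obtain ⟨s₂, hs₂⟩ : ∃ s₂, s₂ = (const 23 1).eval ((load 27 6 25).eval ((load 26 5 25).eval ((load 25 14 22).eval ((Prog.add 24 24 14).eval s₁)))) := ⟨_, rfl⟩
    rw [← hs₂]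
    have q24 : s₂.reg 24 = i * S := by
      obtain ⟨i, rfl⟩ := Nat.exists_eq_add_of_le hi1
      simp [hs₂, Prog.eval, State.setReg, h24, e14]
      ring
    have q26 : s₂.reg 26 = D i / t := by
      simp [hs₂, Prog.eval, State.setReg, a₁, h22, ← hD, hci.1]
    have q27 : s₂.reg 27 = D i % t := by
      simp [hs₂, Prog.eval, State.setReg, a₁, h22, ← hD, hci.2]
    have q22 : s₂.reg 22 = i := by simp [hs₂, Prog.eval, State.setReg, h22]
    have q18 : s₂.reg 18 = k + 1 := by simp [hs₂, Prog.eval, State.setReg, e18]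
    have q2 : s₂.reg 2 = 1 := by simp [hs₂, Prog.eval, State.setReg, e2]
    have q21 : s₂.reg 21 = s₁.reg 21 := by simp [hs₂, Prog.eval, State.setReg]
    have a₂ : s₂.arr = s.arr := by rw [← a₁, hs₂]; rfl
    refine (Runs.forLoop_const (a := 1) (N := k + 1) 30 (fun m s' => (s'.reg 21 ≤ 1 ∧ (s'.reg 21 = 0 ↔
      (s₁.reg 21 = 0 ∧ ∀ j, 1 ≤ j → j < m → EntryOk b t (M (i * S + j) = 1) (D i) (D j)))))
      ?_ q18 q2 (by omega) ?_ ?_ ?_).mono ?_ ?_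
    · simp [hs₂, Prog.eval, State.setReg]
    · simp [hw']
    · rw [q21]
      refine ⟨h21, ?_⟩
      have : ∀ j, 1 ≤ j → j < 1 → EntryOk b t (M (i * S + j) = 1) (D i) (D j) := fun j h h' => by omega
      tauto
    · rintro j s₃ hj1 hjk h23 hB ⟨g21, gI⟩
      have a₃ : s₃.arr = s.arr := by
        rw [← a₂]; funext a; exact hB.arr a (hwa a)
      have hDj : D j < t * t := hD ▸ hd j hj1 (by omega)
      have hcj := h5 (D j) hDj
      have key := eval_entryTest b (s := s₃) (t := t) (i := i) (j := j) (S := S) h23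
        ((hB.reg 24 hw.2.2.2.1).trans q24)
        (by rw [hB.reg 26 (by simp [forLoop, Prog.writesReg, hw']), q26, a₃, ← hD])
        (by rw [hB.reg 27 (by simp [forLoop, Prog.writesReg, hw']), q27, a₃, ← hD])
        (by rw [a₃, ← hD]; exact hcj.1) (by rw [a₃, ← hD]; exact hcj.2) (by rw [a₃]; exact h15 _)
      rw [a₃, ← hM, ← hD] at key
      refine (Runs.eval (loopFree_entryTest b) ?_).mono (cost_entryTest b) fun _ _ h => h
      have hr : ∀ s' : State, (s'.setReg 23 (j + 1)).reg 21 = s'.reg 21 := fun s' => by simp [State.setReg]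
      rw [hr]
      have hsplit : (∀ j', 1 ≤ j' → j' < j + 1 → EntryOk b t (M (i * S + j') = 1) (D i) (D j')) ↔
          (∀ j', 1 ≤ j' → j' < j → EntryOk b t (M (i * S + j') = 1) (D i) (D j')) ∧
          EntryOk b t (M (i * S + j) = 1) (D i) (D j) := by
        constructor
        · exact fun h => ⟨fun j' h1 h2 => h j' h1 (by omega), h j hj1 (by omega)⟩
        · rintro ⟨h, h'⟩ j' h1 h2
          rcases Nat.lt_succ_iff_lt_or_eq.1 h2 with h3 | rfl
          · exact h j' h1 h3
          · exact h'
      rw [hsplit]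
      by_cases hE : EntryOk b t (M (i * S + j) = 1) (D i) (D j)
      · rw [key.1 hE]
        exact ⟨g21, by tauto⟩
      · rw [key.2 hE]
        refine ⟨le_rfl, ?_⟩
        simp [hE]
    · simp; omega
    · rintro s₃ hB ⟨g21, gI⟩
      have hr : ∀ s' : State, (s'.setReg 22 (i + 1)).reg 21 = s'.reg 21 := fun s' => by simp [State.setReg]
      have hr' : ∀ s' : State, (s'.setReg 22 (i + 1)).reg 24 = s'.reg 24 := fun s' => by simp [State.setReg]
      rw [hr, hr', hB.reg 24 hw.2.2.2.1, q24, gI, hI]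
      refine ⟨by simp, g21, ?_⟩
      constructor
      · rintro ⟨h, h'⟩ i' h1 h2
        rcases Nat.lt_succ_iff_lt_or_eq.1 h2 with h3 | rfl
        · exact h i' h1 h3
        · exact h'
      · exact fun h => ⟨fun i' h1 h2 => h i' h1 (by omega), h i hi1 (by omega)⟩
  · simp
  · rintro s' - ⟨-, h1, h2⟩
    have : AllOk b t k S M D ↔ s'.reg 21 = 0 := by
      rw [h2]; simp only [AllOk, Nat.lt_succ_iff]
    rw [← hM, ← hD, this]
    exact ⟨id, by omega⟩

/-! ## Enumerating all assignments -/

/-- The number with the digits `d 1, …, d F` in base `T`. -/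
def digitVal (T F : ℕ) (d : ℕ → ℕ) : ℕ := ∑ i ∈ Finset.range F, d (i + 1) * T ^ i

theorem digitVal_succ (T F : ℕ) (d : ℕ → ℕ) :
    digitVal T (F + 1) d = digitVal T F d + d (F + 1) * T ^ F := Finset.sum_range_succ _ _

theorem digitVal_lt {T F : ℕ} {d : ℕ → ℕ} (h : ∀ i, 1 ≤ i → i ≤ F → d i < T) :
    digitVal T F d < T ^ F := by
  induction F with
  | zero => simp [digitVal]
  | succ F ih =>
    have h1 := ih fun i h1 h2 => h i h1 (by omega)
    have h2 := h (F + 1) (by omega) le_rfl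
    rw [digitVal_succ, pow_succ]
    nlinarith

/-- Division by T^F reads off the top digit, because the lower digits amount to less than T^F. -/
theorem digitVal_inj {T F : ℕ} {d e : ℕ → ℕ} (hd : ∀ i, 1 ≤ i → i ≤ F → d i < T)
    (he : ∀ i, 1 ≤ i → i ≤ F → e i < T) (h : digitVal T F d = digitVal T F e) :
    ∀ i, 1 ≤ i → i ≤ F → d i = e i := by
  induction F with
  | zero => intro i h1 h2; omega
  | succ F ih =>
    have h1 : digitVal T F d < T ^ F := digitVal_lt fun i h1 h2 => hd i h1 (by omega)
    have h2 : digitVal T F e < T ^ F := digitVal_lt fun i h1 h2 => he i h1 (by omega)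
    rw [digitVal_succ, digitVal_succ] at h
    have htop : d (F + 1) = e (F + 1) := by
      have := congrArg (· / T ^ F) h
      simpa [Nat.add_mul_div_right _ _ (show 0 < T ^ F by omega), Nat.div_eq_of_lt h1, Nat.div_eq_of_lt h2] using this
    rw [htop] at h
    intro i hi1 hi2
    rcases Nat.lt_succ_iff_lt_or_eq.1 (Nat.lt_succ_of_le hi2) with h3 | rfl
    · exact ih (fun i h1 h2 => hd i h1 (by omega)) (fun i h1 h2 => he i h1 (by omega)) (by omega) i hi1 (by omega)
    · exact htop

/-- The last equation, restricted to the digits already treated, is the loop invariant; for no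
digits it says that the initial carry is 1. -/
theorem run_incrProg {s : State} {T F : ℕ} (h2 : s.reg 2 = 1) (h3 : s.reg 3 = 0) (h4 : s.reg 4 = T)
    (h32 : s.reg 32 = F + 1) (hd : ∀ i, 1 ≤ i → i ≤ F → s.arr 14 i < T) :
    Runs incrProg s (20 * (F + 1)) fun s' =>
      (∀ i, 1 ≤ i → i ≤ F → s'.arr 14 i < T) ∧ (∀ i, ¬ (1 ≤ i ∧ i ≤ F) → s'.arr 14 i = s.arr 14 i) ∧
      s'.reg 20 ≤ 1 ∧
      digitVal T F (s'.arr 14) + s'.reg 20 * T ^ F = digitVal T F (s.arr 14) + 1 := by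
  unfold incrProg
  rw [block_cons]; refine Runs.eval_seq rfl (c := 20 * F + 10) ?_ (by simp [Prog.cost]; omega)
  rw [block_cons]; refine Runs.eval_seq rfl (c := 20 * F + 9) ?_ (by simp [Prog.cost]; omega)
  rw [block_singleton]
  refine (Runs.forLoop_const (a := 1) (N := F + 1) 7 (fun m s' =>
    (∀ i, 1 ≤ i → i < m → s'.arr 14 i < T) ∧ (∀ i, ¬ (1 ≤ i ∧ i < m) → s'.arr 14 i = s.arr 14 i) ∧
      s'.reg 20 ≤ 1 ∧
      digitVal T (m - 1) (s'.arr 14) + s'.reg 20 * T ^ (m - 1) = digitVal T (m - 1) (s.arr 14) + 1)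
      ?_ ?_ ?_ (by omega) (by decide) ?_ ?_).mono ?_ ?_
  · simp [Prog.eval, State.setReg]
  · simp [Prog.eval, State.setReg, h32]
  · simp [Prog.eval, State.setReg, h2]
  · simp [Prog.eval, State.setReg, digitVal]
    intro i h1 h2
    omega
  · rintro m s₁ hm1 hmF h22 hA ⟨g1, g2, g3, g4⟩
    have e3 : s₁.reg 3 = 0 := by rw [hA.reg 3 rfl]; simp [Prog.eval, State.setReg, h3]
    have e4 : s₁.reg 4 = T := by rw [hA.reg 4 rfl]; simp [Prog.eval, State.setReg, h4]
    have hm0 := g2 m (by omega)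
    have hdm := hd m hm1 (by omega)
    obtain ⟨m, rfl⟩ := Nat.exists_eq_add_of_le' hm1
    refine Runs.eval rfl ?_
    have hval : ∀ x, digitVal T m (Function.update (s₁.arr 14) (m + 1) x) = digitVal T m (s₁.arr 14) := by
      intro x
      refine Finset.sum_congr rfl fun i hi => ?_
      have := Finset.mem_range.1 hi
      rw [Function.update_of_ne (by omega)]
    rw [Nat.add_sub_cancel] at g4
    have hT : digitVal T (m + 1) (s.arr 14) = digitVal T m (s.arr 14) + s.arr 14 (m + 1) * T ^ m :=
      digitVal_succ ..
    by_cases hc : s₁.arr 14 (m + 1) + s₁.reg 20 < T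
    · have E : ((block [.load 25 14 22, .add 25 25 20,
        .ite 25 4 (block [.store 14 22 25, .const 20 0]) (block [.store 14 22 3, .const 20 1])]).eval s₁).arr 14 =
          Function.update (s₁.arr 14) (m + 1) (s₁.arr 14 (m + 1) + s₁.reg 20) := by
        simp [block, Prog.eval, State.setReg, State.setCell, h22, e4, hc]
      have E' : ((block [.load 25 14 22, .add 25 25 20,
        .ite 25 4 (block [.store 14 22 25, .const 20 0]) (block [.store 14 22 3, .const 20 1])]).eval s₁).reg 20 = 0 := by
        simp [block, Prog.eval, State.setReg, State.setCell, h22, e4, hc]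
      generalize (block [.load 25 14 22, .add 25 25 20,
        .ite 25 4 (block [.store 14 22 25, .const 20 0]) (block [.store 14 22 3, .const 20 1])]).eval s₁ = s₂ at E E' ⊢
      have hr : ∀ x, (s₂.setReg 22 x).reg 20 = s₂.reg 20 := fun x => by simp [State.setReg]
      have ha : ∀ x, (s₂.setReg 22 x).arr = s₂.arr := fun x => rfl
      rw [hr, ha, E, E']
      refine ⟨fun i h1 h2 => ?_, fun i hi => ?_, by omega, ?_⟩
      · rw [Function.update_apply]
        split_ifs
        · exact hc
        · exact g1 i h1 (by omega)
      · rw [Function.update_of_ne (by omega)]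
        exact g2 i (by omega)
      · rw [Nat.add_sub_cancel, digitVal_succ, hval, Function.update_self, hT, hm0]
        nlinarith
    · have E : ((block [.load 25 14 22, .add 25 25 20,
        .ite 25 4 (block [.store 14 22 25, .const 20 0]) (block [.store 14 22 3, .const 20 1])]).eval s₁).arr 14 =
          Function.update (s₁.arr 14) (m + 1) 0 := by
        simp [block, Prog.eval, State.setReg, State.setCell, h22, e4, hc, e3]
      have E' : ((block [.load 25 14 22, .add 25 25 20,
        .ite 25 4 (block [.store 14 22 25, .const 20 0]) (block [.store 14 22 3, .const 20 1])]).eval s₁).reg 20 = 1 := by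
        simp [block, Prog.eval, State.setReg, State.setCell, h22, e4, hc]
      generalize (block [.load 25 14 22, .add 25 25 20,
        .ite 25 4 (block [.store 14 22 25, .const 20 0]) (block [.store 14 22 3, .const 20 1])]).eval s₁ = s₂ at E E' ⊢
      have hr : ∀ x, (s₂.setReg 22 x).reg 20 = s₂.reg 20 := fun x => by simp [State.setReg]
      have ha : ∀ x, (s₂.setReg 22 x).arr = s₂.arr := fun x => rfl
      rw [hr, ha, E, E']
      have hc1 : s₁.reg 20 = 1 := by omega
      -- A digit below T overflows with a carry of at most 1 only if it is T - 1 and the carry is 1;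
      -- then zero is the correct new digit.
      have hcT : s.arr 14 (m + 1) + 1 = T := by omega
      refine ⟨fun i h1 h2 => ?_, fun i hi => ?_, by omega, ?_⟩
      · rw [Function.update_apply]
        split_ifs
        · omega
        · exact g1 i h1 (by omega)
      · rw [Function.update_of_ne (by omega)]
        exact g2 i (by omega)
      · rw [Nat.add_sub_cancel, digitVal_succ, hval, Function.update_self, hT, pow_succ]
        rw [hc1] at g4
        have : T ^ m * T = T ^ m * s.arr 14 (m + 1) + T ^ m := by rw [← hcT]; ring
        nlinarith
  · simp; omega
  · rintro s' - ⟨g1, g2, g3, g4⟩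
    exact ⟨fun i h1 h2 => g1 i h1 (by omega), fun i hi => g2 i (by omega), g3, by simpa using g4⟩

/-- The counter starts at 0, so round q checks the only candidate of value q, and (t²)^F rounds
exhaust all candidates. The carry is 0 before each round and 1 after the last. -/
theorem run_searchProg (b : Bool) {s : State} {t k S F : ℕ} (h2 : s.reg 2 = 1) (h3 : s.reg 3 = 0)
    (h4 : s.reg 4 = t * t) (h14 : s.reg 14 = S) (h15 : s.reg 15 = k) (h17 : s.reg 17 = F)
    (h19 : s.reg 19 = 0) (hFk : F ≤ k) (hN : 0 < (t * t) ^ F)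
    (h5 : ∀ c < t * t, s.arr 5 c = c / t ∧ s.arr 6 c = c % t)
    (hM : ∀ x, s.arr 15 x ≤ 1) (hd : ∀ i, 1 ≤ i → i ≤ k → s.arr 14 i < t * t)
    (hd0 : ∀ i, 1 ≤ i → i ≤ F → s.arr 14 i = 0) :
    Runs (searchProg b) s (200 * ((t * t) ^ F * ((k + 1) * (k + 1)))) fun s' =>
      ((∃ d : ℕ → ℕ, (∀ i, 1 ≤ i → i ≤ F → d i < t * t) ∧
        (∀ i, ¬ (1 ≤ i ∧ i ≤ F) → d i = s.arr 14 i) ∧ AllOk b t k S (s.arr 15) d) →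
        s'.reg 19 = 1) ∧
      ((¬ ∃ d : ℕ → ℕ, (∀ i, 1 ≤ i → i ≤ F → d i < t * t) ∧
        (∀ i, ¬ (1 ≤ i ∧ i ≤ F) → d i = s.arr 14 i) ∧ AllOk b t k S (s.arr 15) d) →
        s'.reg 19 = 0) := by
  obtain ⟨D, hD⟩ : ∃ D, D = s.arr 14 := ⟨_, rfl⟩
  obtain ⟨M, hM'⟩ : ∃ M, M = s.arr 15 := ⟨_, rfl⟩
  rw [← hD, ← hM']
  let Cand : (ℕ → ℕ) → Prop := fun d => (∀ i, 1 ≤ i → i ≤ F → d i < t * t) ∧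
        ∀ i, ¬ (1 ≤ i ∧ i ≤ F) → d i = D i
  have hcost : (t * t) ^ F * (60 * ((k + 1) * (k + 1)) + 3 + 20 * (F + 1) + 1) + 1 + 3 ≤
      200 * ((t * t) ^ F * ((k + 1) * (k + 1))) := by
    have h1 : 1 ≤ (k + 1) * (k + 1) := by nlinarith
    have h2 : F + 1 ≤ (k + 1) * (k + 1) := by nlinarith
    have h3 := Nat.mul_le_mul_left ((t * t) ^ F) h1
    have h4 := Nat.mul_le_mul_left ((t * t) ^ F) h2
    nlinarith
  unfold searchProg
  rw [block_cons]; refine Runs.eval_seq rfl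
    (c := (t * t) ^ F * (60 * ((k + 1) * (k + 1)) + 3 + 20 * (F + 1) + 1) + 1 + 2) ?_ (by simp only [Prog.cost]; omega)
  rw [block_cons]; refine Runs.eval_seq rfl
    (c := (t * t) ^ F * (60 * ((k + 1) * (k + 1)) + 3 + 20 * (F + 1) + 1) + 1 + 1) ?_ (by simp only [Prog.cost]; omega)
  rw [block_cons]; refine Runs.eval_seq rfl
    (c := (t * t) ^ F * (60 * ((k + 1) * (k + 1)) + 3 + 20 * (F + 1) + 1) + 1) ?_ (by simp only [Prog.cost]; omega)
  rw [block_singleton]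
  obtain ⟨s₀, hs₀⟩ : ∃ s₀, s₀ = (const 20 0).eval ((Prog.add 32 17 2).eval ((Prog.add 18 15 2).eval s)) := ⟨_, rfl⟩
  rw [← hs₀]
  have r₀ : ∀ r, r ≠ 18 → r ≠ 32 → r ≠ 20 → s₀.reg r = s.reg r := by
    intro r h1 h2 h3
    simp [hs₀, Prog.eval, State.setReg, h1, h2, h3]
  have a₀ : s₀.arr = s.arr := by rw [hs₀]; rfl
  refine (Runs.loop (j₀ := 0) (N := (t * t) ^ F) (fun _ => 60 * ((k + 1) * (k + 1)) + 3 + 20 * (F + 1))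
    (fun q s' => (s'.reg 2 = 1 ∧ s'.reg 3 = 0 ∧ s'.reg 4 = t * t ∧ s'.reg 14 = S ∧ s'.reg 18 = k + 1 ∧
      s'.reg 32 = F + 1 ∧ s'.arr 15 = M ∧ s'.arr 5 = s.arr 5 ∧ s'.arr 6 = s.arr 6) ∧
      Cand (s'.arr 14) ∧ s'.reg 19 ≤ 1 ∧
      (s'.reg 19 = 1 ↔ ∃ d, Cand d ∧ digitVal (t * t) F d < q ∧ AllOk b t k S M d) ∧
      (q < (t * t) ^ F → s'.reg 20 = 0 ∧ digitVal (t * t) F (s'.arr 14) = q) ∧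
      (q = (t * t) ^ F → s'.reg 20 = 1)) (by omega) ?_ ?_ ?_).mono ?_ ?_
  · refine ⟨?_, ?_, ?_, ?_, ?_, ?_⟩
    · simp [hs₀, Prog.eval, State.setReg, h2, h3, h4, h14, h15, h17, hM']
    · rw [a₀, ← hD]
      exact ⟨fun i h1 h2 => hD ▸ hd i h1 (by omega), fun _ _ => rfl⟩
    · rw [r₀ 19 (by decide) (by decide) (by decide), h19]; omega
    · rw [r₀ 19 (by decide) (by decide) (by decide), h19]; simp
    · intro _
      refine ⟨by simp [hs₀, Prog.eval, State.setReg], ?_⟩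
      rw [a₀]
      refine Finset.sum_eq_zero fun i hi => ?_
      have := Finset.mem_range.1 hi
      rw [hd0 (i + 1) (by omega) (by omega), zero_mul]
    · intro h; omega
  · rintro q s' hq ⟨⟨e2, -⟩, -, -, -, hlt, heq⟩
    rw [e2]
    rcases Nat.lt_or_eq_of_le hq with h | h
    · rw [(hlt h).1]; simp [h]
    · rw [heq h]; simp [h]
  · rintro q s₁ - hq ⟨⟨e2, e3, e4, e14, e18, e32, m15, m5, m6⟩, hC, h19, hres, hlt, -⟩
    obtain ⟨e20, hval⟩ := hlt hq
    have hC' : ∀ i, 1 ≤ i → i ≤ k → s₁.arr 14 i < t * t := by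
      intro i h1 h2
      by_cases hi : i ≤ F
      · exact hC.1 i h1 hi
      · rw [hC.2 i (by omega), hD]; exact hd i h1 h2
    rw [block_cons]
    refine Runs.seq' (d := 3 + 20 * (F + 1)) (run_checkProg b e2 e18 e14 (by rw [m5, m6]; exact h5) (by rw [m15, hM']; exact hM) hC') ?_
      (by omega)
    rintro s₂ hA ⟨hok, hnok⟩
    rw [m15] at hok hnok
    have hwr : ∀ r ∈ [2, 3, 4, 14, 18, 32, 19], (checkProg b).writesReg r = false := by
      cases b <;> decide
    have hwa : ∀ a, (checkProg b).writesArr a = false := by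
      cases b <;> exact fun a => rfl
    rw [block_cons]
    refine Runs.eval_seq rfl (c := 20 * (F + 1)) ?_ (by simp only [Prog.cost]; omega)
    rw [block_singleton]
    obtain ⟨s₃, hs₃⟩ : ∃ s₃, s₃ = (Prog.ite 21 2 (const 19 1) skip).eval s₂ := ⟨_, rfl⟩
    rw [← hs₃]
    have a₃ : s₃.arr = s₁.arr := by
      rw [hs₃]
      funext a
      rw [← hA.arr a (hwa a), Prog.eval]
      split_ifs <;> rfl
    have r₃ : ∀ r ∈ [2, 3, 4, 14, 18, 32], s₃.reg r = s₁.reg r := by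
      intro r hr
      simp only [List.mem_cons, List.not_mem_nil, or_false] at hr
      have h19 : r ≠ 19 := by omega
      have hr' := hA.reg r (hwr r (by simp only [List.mem_cons, List.not_mem_nil, or_false]; omega))
      rw [hs₃, ← hr', Prog.eval]
      split_ifs
      · simp only [Prog.eval, State.setReg, Function.update_of_ne h19]
      · simp only [Prog.eval]
    have hs19 : (AllOk b t k S M (s₁.arr 14) → s₃.reg 19 = 1) ∧
        (¬ AllOk b t k S M (s₁.arr 14) → s₃.reg 19 = s₁.reg 19) := by
      have f2 : s₂.reg 2 = 1 := (hA.reg 2 (hwr 2 (by simp))).trans e2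
      have f19 := hA.reg 19 (hwr 19 (by simp))
      constructor <;> intro h
      · rw [hs₃, Prog.eval, if_pos (by rw [hok h, f2]; omega)]
        simp [Prog.eval, State.setReg]
      · rw [hs₃, Prog.eval, if_neg (by rw [hnok h, f2]; omega)]
        exact f19
    refine (run_incrProg ((r₃ 2 (by simp)).trans e2) ((r₃ 3 (by simp)).trans e3)
      ((r₃ 4 (by simp)).trans e4) ((r₃ 32 (by simp)).trans e32) (by rw [a₃]; exact hC.1)).mono le_rfl ?_
    rintro s₄ hB ⟨i1, i2, i3, i4⟩
    have w19 : s₄.reg 19 = s₃.reg 19 := hB.reg 19 rfl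
    rw [a₃] at i2 i4
    have hCand : Cand (s₄.arr 14) := ⟨i1, fun i hi => (i2 i hi).trans (hC.2 i hi)⟩
    have hlt4 := digitVal_lt i1
    refine ⟨⟨?_, ?_, ?_, ?_, ?_, ?_, ?_, ?_, ?_⟩, hCand, ?_, ?_, ?_, ?_⟩
    · rw [hB.reg 2 rfl, r₃ 2 (by simp), e2]
    · rw [hB.reg 3 rfl, r₃ 3 (by simp), e3]
    · rw [hB.reg 4 rfl, r₃ 4 (by simp), e4]
    · rw [hB.reg 14 rfl, r₃ 14 (by simp), e14]
    · rw [hB.reg 18 rfl, r₃ 18 (by simp), e18]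
    · rw [hB.reg 32 rfl, r₃ 32 (by simp), e32]
    · rw [hB.arr 15 rfl, a₃, m15]
    · rw [hB.arr 5 rfl, a₃, m5]
    · rw [hB.arr 6 rfl, a₃, m6]
    · rw [w19]
      by_cases h : AllOk b t k S M (s₁.arr 14)
      · rw [hs19.1 h]
      · rw [hs19.2 h]; exact h19
    · rw [w19]
      by_cases h : AllOk b t k S M (s₁.arr 14)
      · rw [hs19.1 h]
        exact iff_of_true rfl ⟨_, hC, by omega, h⟩
      · rw [hs19.2 h, hres]
        constructor
        · rintro ⟨d, g1, g2, g3⟩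
          exact ⟨d, g1, by omega, g3⟩
        · rintro ⟨d, g1, g2, g3⟩
          refine ⟨d, g1, ?_, g3⟩
          rcases Nat.lt_succ_iff_lt_or_eq.1 g2 with g | g
          · exact g
          · exfalso
            -- A candidate of value q has the digits of the current assignment, and outside 1, …, F
            -- both equal `D`; so it is the one just checked.
            have heq := digitVal_inj g1.1 hC.1 (g.trans hval.symm)
            have : d = s₁.arr 14 := by
              funext i
              by_cases hi : 1 ≤ i ∧ i ≤ F
              · exact heq i hi.1 hi.2
              · rw [g1.2 i hi, hC.2 i hi]
            exact h (this ▸ g3)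
    · intro hq'
      rw [hval] at i4
      rcases Nat.le_one_iff_eq_zero_or_eq_one.1 i3 with h | h
      · rw [h] at i4 ⊢
        exact ⟨rfl, by omega⟩
      · rw [h] at i4; omega
    · intro hq'
      rw [hval] at i4
      rcases Nat.le_one_iff_eq_zero_or_eq_one.1 i3 with h | h
      · rw [h] at i4; omega
      · exact h
  · simp
  · rintro s' - ⟨-, -, h19, hres, -⟩
    have : (∃ d : ℕ → ℕ, (∀ i, 1 ≤ i → i ≤ F → d i < t * t) ∧
        (∀ i, ¬ (1 ≤ i ∧ i ≤ F) → d i = D i) ∧ AllOk b t k S M d) ↔ s'.reg 19 = 1 := by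
      rw [hres]
      constructor
      · rintro ⟨d, g1, g2, g3⟩
        exact ⟨d, ⟨g1, g2⟩, digitVal_lt g1, g3⟩
      · rintro ⟨d, ⟨g1, g2⟩, -, g3⟩
        exact ⟨d, g1, g2, g3⟩
    rw [this]
    exact ⟨id, by omega⟩

/-! ## Reduction to representatives -/

theorem Subpath.inter_nonempty_iff {t : ℕ} (P Q : Subpath t) :
    (P.verts ∩ Q.verts).Nonempty ↔ P.left ≤ Q.right ∧ Q.left ≤ P.right := by
  have := P.left_le_right
  have := Q.left_le_right
  rw [Subpath.verts, Subpath.verts, Set.Icc_inter_Icc, Set.nonempty_Icc, sup_le_iff, le_inf_iff,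
    le_inf_iff]
  tauto

theorem Subpath.ssubset_iff {t : ℕ} (P Q : Subpath t) :
    P.verts ⊂ Q.verts ↔
      Q.left ≤ P.left ∧ P.right ≤ Q.right ∧ (Q.left < P.left ∨ P.right < Q.right) := by
  rw [ssubset_iff_subset_not_subset, Subpath.verts, Subpath.verts,
    Set.Icc_subset_Icc_iff P.left_le_right, Set.Icc_subset_Icc_iff Q.left_le_right, and_assoc,
    not_and_or, not_le, not_le]

/-- The number that encodes a subpath. -/
def Subpath.code {t : ℕ} (P : Subpath t) : ℕ := P.left * t + P.right

theorem Subpath.code_div {t : ℕ} (P : Subpath t) : P.code / t = P.left := by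
  rw [Subpath.code, mul_comm, Nat.mul_add_div P.left.pos, Nat.div_eq_of_lt P.right.2, add_zero]

theorem Subpath.code_mod {t : ℕ} (P : Subpath t) : P.code % t = P.right := by
  rw [Subpath.code, mul_comm, Nat.mul_add_mod, Nat.mod_eq_of_lt P.right.2]

theorem Subpath.code_lt {t : ℕ} (P : Subpath t) : P.code < t * t := by
  have := P.left.2
  have := P.right.2
  rw [Subpath.code]
  nlinarith

theorem Subpath.code_injective {t : ℕ} {P Q : Subpath t} (h : P.code = Q.code) : P = Q := by
  ext
  · rw [← P.code_div, ← Q.code_div, h]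
  · rw [← P.code_mod, ← Q.code_mod, h]

instance (t : ℕ) : Finite (Subpath t) :=
  Finite.of_injective (fun P => (⟨P.code, P.code_lt⟩ : Fin (t * t))) fun P Q h =>
    Subpath.code_injective (by simpa using h)

/-- A subpath is determined by the unordered pair of its ends. The saving over t² is essential: with
F up to t² the assignments alone could number t^(2t²), leaving no room for the check of each. -/
theorem two_mul_card_subpath_le (t : ℕ) : 2 * Nat.card (Subpath t) ≤ t * t + t := by
  have h : Nat.card (Subpath t) ≤ Nat.card (Sym2 (Fin t)) := by
    refine Nat.card_le_card_of_injective (fun P => s(P.left, P.right)) fun P Q h => ?_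
    have := P.left_le_right
    have := Q.left_le_right
    rcases Sym2.eq_iff.1 h with ⟨h1, h2⟩ | ⟨h1, h2⟩
    · exact Subpath.ext h1 h2
    · exact Subpath.ext (by order) (by order)
  rw [Nat.card_eq_fintype_card (α := Sym2 _), Sym2.card, Fintype.card_fin, Nat.choose_two_right,
    Nat.add_sub_cancel] at h
  have := Nat.div_mul_le_self ((t + 1) * t) 2
  nlinarith

/-- The two problems; `b` tells whether the representation has to be proper. -/
def Problem (b : Bool) (I : Instance) : Prop :=
  ∃ R : Fin I.n → Subpath I.t, IsIntRep I.G R ∧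
    (b = true → ∀ u v, ¬ (R u).verts ⊂ (R v).verts) ∧ I.Extends R

theorem problem_false (I : Instance) : Problem false I ↔ RepExtIntFixed I := by
  simp [Problem, RepExtIntFixed]

theorem problem_true (I : Instance) : Problem true I ↔ RepExtPintFixed I := by
  simp [Problem, RepExtPintFixed, IsPintRep, and_assoc]

/-- `v` is in the closed neighbourhood of `u`. -/
def Instance.CAdj (I : Instance) (u v : Fin I.n) : Prop := u = v ∨ I.G.Adj u v

theorem Instance.cAdj_comm (I : Instance) {u v : Fin I.n} : I.CAdj u v ↔ I.CAdj v u := by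
  rw [CAdj, CAdj, I.G.adj_comm, eq_comm]

/-- The vertices have the same closed neighbourhood and the same prescribed subpath. -/
def Instance.Twin (I : Instance) (u v : Fin I.n) : Prop :=
  I.pre u = I.pre v ∧ ∀ w, I.CAdj w u ↔ I.CAdj w v

theorem Instance.Twin.cAdj {I : Instance} {u v u' v' : Fin I.n} (h : I.Twin u u')
    (h' : I.Twin v v') : I.CAdj u v ↔ I.CAdj u' v' := by
  rw [h'.2 u, I.cAdj_comm, h.2 v', I.cAdj_comm]

/-- Every subpath meets itself, so with closed adjacency the condition extends to the diagonal and
the restriction to distinct vertices disappears. -/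
theorem isIntRep_iff {I : Instance} {R : Fin I.n → Subpath I.t} :
    IsIntRep I.G R ↔
      ∀ u v, I.CAdj u v ↔ (R u).left ≤ (R v).right ∧ (R v).left ≤ (R u).right := by
  simp only [IsIntRep, Subpath.inter_nonempty_iff]
  constructor
  · intro h u v
    by_cases e : u = v
    · subst e
      simp [Instance.CAdj, (R u).left_le_right]
    · rw [← h u v e]
      simp [Instance.CAdj, e]
  · intro h u v e
    rw [← h u v]
    simp [Instance.CAdj, e]

theorem entryOk_code {b : Bool} {t : ℕ} {adj : Prop} {P Q : Subpath t} :
    EntryOk b t adj P.code Q.code ↔ (adj ↔ P.left ≤ Q.right ∧ Q.left ≤ P.right) ∧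
      (b = true → ¬ P.verts ⊂ Q.verts) := by
  simp only [EntryOk, Subpath.code_div, Subpath.code_mod, Subpath.ssubset_iff, Fin.le_def,
    Fin.lt_def]

/-- `num` numbers the elements of a system of representatives of the twin classes by `1, …, k` and
all other vertices by `0`; the representatives without prescribed subpath have the numbers
`1, …, F`. -/
structure Instance.Numbering (I : Instance) (num : Fin I.n → ℕ) (k F : ℕ) : Prop where
  le : ∀ v, num v ≤ k
  surj : ∀ i, 1 ≤ i → i ≤ k → ∃ v, num v = i
  inj : ∀ u v, num u ≠ 0 → num u = num v → u = v
  twin_inj : ∀ u v, num u ≠ 0 → num v ≠ 0 → I.Twin u v → u = v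
  cover : ∀ u, ∃ r, num r ≠ 0 ∧ I.Twin r u
  free : ∀ v, num v ≠ 0 → (num v ≤ F ↔ I.pre v = none)
  le_k : F ≤ k

/-- Vertices with the same subpath in a representation have the same closed neighbourhood. -/
theorem cAdj_iff_of_eq {I : Instance} {R : Fin I.n → Subpath I.t} (hR : IsIntRep I.G R)
    {u v : Fin I.n} (h : R u = R v) (w : Fin I.n) : I.CAdj w u ↔ I.CAdj w v := by
  rw [isIntRep_iff] at hR
  rw [hR, hR, h]

/-- Representatives that share a subpath are twins, hence equal, provided both are free or both are
pre-drawn. So a representative is determined by its subpath and one bit, and a free one by its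
subpath alone. -/
theorem Instance.Numbering.bounds {b : Bool} {I : Instance} {num : Fin I.n → ℕ} {k F : ℕ}
    (h : I.Numbering num k F) (hI : Problem b I) : 2 * F ≤ I.t * I.t + I.t ∧ k ≤ I.t * I.t + I.t := by
  obtain ⟨R, hR, -, hext⟩ := hI
  have hcard := two_mul_card_subpath_le I.t
  have hg : ∀ i : Fin k, ∃ v, num v = i + 1 := fun i => h.surj _ (by omega) (by omega)
  choose g hg using hg
  have key : ∀ i j : Fin k, R (g i) = R (g j) → ((i : ℕ) < F ↔ (j : ℕ) < F) → i = j := by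
    intro i j hij hF
    have hi := h.free (g i) (by rw [hg]; omega)
    have hj := h.free (g j) (by rw [hg]; omega)
    have hpre : I.pre (g i) = I.pre (g j) := by
      by_cases hi' : (i : ℕ) < F
      · rw [hi.1 (by rw [hg]; omega), hj.1 (by rw [hg]; omega)]
      · have hi'' : I.pre (g i) ≠ none := fun e => by have := hi.2 e; rw [hg] at this; omega
        have hj'' : I.pre (g j) ≠ none := fun e => by have := hj.2 e; rw [hg] at this; omega
        obtain ⟨P, hP⟩ := Option.ne_none_iff_exists'.1 hi''
        obtain ⟨Q, hQ⟩ := Option.ne_none_iff_exists'.1 hj''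
        -- Pre-drawn vertices keep their prescription in `R`, so equal subpaths give equal
        -- prescriptions.
        rw [hP, hQ, ← hext _ _ hP, ← hext _ _ hQ, hij]
    have := h.twin_inj (g i) (g j) (by rw [hg]; omega) (by rw [hg]; omega)
      ⟨hpre, cAdj_iff_of_eq hR hij⟩
    have := congrArg num this
    rw [hg, hg] at this
    exact Fin.ext (by omega)
  constructor
  · have : Nat.card (Fin F) ≤ Nat.card (Subpath I.t) :=
      Nat.card_le_card_of_injective (fun i : Fin F => R (g (i.castLE h.le_k))) fun i j hij => by
        have := key _ _ hij (by simp)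
        simpa [Fin.ext_iff] using this
    rw [Nat.card_fin] at this
    omega
  · have : Nat.card (Fin k) ≤ Nat.card (Subpath I.t × Bool) :=
      Nat.card_le_card_of_injective (fun i : Fin k => (R (g i), decide ((i : ℕ) < F)))
        fun i j hij => by
          simp only [Prod.mk.injEq, decide_eq_decide] at hij
          exact key i j hij.1 hij.2
    rw [Nat.card_fin, Nat.card_prod, Nat.card_eq_fintype_card (α := Bool), Fintype.card_bool] at this
    omega

/-- A representation is restricted to the representatives in one direction; in the other, each
vertex copies the subpath of its representative, and closed adjacency does not change when vertices
are replaced by twins. -/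
theorem Instance.Numbering.problem_iff {b : Bool} {I : Instance} {num : Fin I.n → ℕ} {k F : ℕ}
    (h : I.Numbering num k F) {D : ℕ → ℕ}
    (hD : ∀ v P, num v ≠ 0 → I.pre v = some P → D (num v) = P.code) :
    Problem b I ↔ ∃ d : ℕ → ℕ, (∀ i, 1 ≤ i → i ≤ F → d i < I.t * I.t) ∧
      (∀ i, ¬ (1 ≤ i ∧ i ≤ F) → d i = D i) ∧
      ∀ u v, num u ≠ 0 → num v ≠ 0 → EntryOk b I.t (I.CAdj u v) (d (num u)) (d (num v)) := by
  constructor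
  · rintro ⟨R, hR, hprop, hext⟩
    have hg : ∀ i, ∃ c, ∀ v, num v = i → i ≠ 0 → c = (R v).code := by
      intro i
      by_cases hi : 1 ≤ i ∧ i ≤ k
      · obtain ⟨v, hv⟩ := h.surj i hi.1 hi.2
        refine ⟨(R v).code, fun w hw h0 => ?_⟩
        rw [h.inj v w (by omega) (by omega)]
      · refine ⟨0, fun v hv h0 => ?_⟩
        have := h.le v
        omega
    choose g hg using hg
    have hdv : ∀ v, num v ≠ 0 → (if 1 ≤ num v ∧ num v ≤ F then g (num v) else D (num v)) = (R v).code := by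
      intro v hv
      split_ifs with hF
      · exact hg _ v rfl hv
      · have := mt (h.free v hv).2 (by omega)
        obtain ⟨P, hP⟩ := Option.ne_none_iff_exists'.1 this
        rw [hD v P hv hP, hext v P hP]
    refine ⟨fun i => if 1 ≤ i ∧ i ≤ F then g i else D i, fun i h1 h2 => ?_, fun i hi => if_neg hi,
      fun u v hu hv => ?_⟩
    · obtain ⟨v, rfl⟩ := h.surj i h1 (h2.trans h.le_k)
      have := hdv v (by omega)
      simp only at this ⊢
      rw [this]
      exact (R v).code_lt
    · simp only [hdv u hu, hdv v hv]
      rw [entryOk_code]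
      exact ⟨isIntRep_iff.1 hR u v, fun hb => hprop hb u v⟩
  · rintro ⟨d, h1, h2, h3⟩
    choose r hr hrt using h.cover
    have hlt : ∀ v, num v ≠ 0 → d (num v) < I.t * I.t := by
      intro v hv
      by_cases hF : num v ≤ F
      · exact h1 _ (by omega) hF
      · obtain ⟨P, hP⟩ := Option.ne_none_iff_exists'.1 (mt (h.free v hv).2 hF)
        rw [h2 _ (by omega), hD v P hv hP]
        exact P.code_lt
    have hP : ∀ v, ∃ P : Subpath I.t, P.code = d (num (r v)) := by
      intro v
      have hv := hlt _ (hr v)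
      have ht : 0 < I.t := Nat.pos_of_ne_zero fun e => by rw [e] at hv; omega
      -- The search runs over all codes, including those with left end beyond right end. The
      -- diagonal test rules these out, since a vertex lies in its own closed neighbourhood.
      have hself := (h3 (r v) (r v) (hr v) (hr v)).1.1 (Or.inl rfl)
      refine ⟨⟨⟨d (num (r v)) / I.t, Nat.div_lt_of_lt_mul hv⟩,
        ⟨d (num (r v)) % I.t, Nat.mod_lt _ ht⟩, Fin.le_def.2 hself.1⟩, ?_⟩
      exact Nat.div_add_mod' _ _
    choose R hR using hP
    have key : ∀ u v, EntryOk b I.t (I.CAdj u v) (R u).code (R v).code := by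
      intro u v
      rw [hR, hR, ← propext ((hrt u).cAdj (hrt v))]
      exact h3 _ _ (hr u) (hr v)
    refine ⟨R, isIntRep_iff.2 fun u v => (entryOk_code.1 (key u v)).1,
      fun hb u v => (entryOk_code.1 (key u v)).2 hb, fun v P hvP => ?_⟩
    have hrP : I.pre (r v) = some P := (hrt v).1.trans hvP
    apply Subpath.code_injective
    -- The representative of a pre-drawn vertex has the same prescription, so its number exceeds `F`
    -- and `d` cannot have altered its code.
    have hnF : ¬ num (r v) ≤ F := fun e => by
      rw [(h.free _ (hr v)).1 e] at hrP
      cases hrP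
    rw [hR, h2 _ (by omega), hD _ P (hr v) hrP]

/-! ## The input -/

/-- The adjacency list of a vertex as a list of numbers. -/
def nbrList {n : ℕ} (adj : Fin n → List (Fin n)) (v : ℕ) : List ℕ :=
  if h : v < n then (adj ⟨v, h⟩).map Fin.val else []

theorem nbrList_coe {n : ℕ} (adj : Fin n → List (Fin n)) (v : Fin n) :
    nbrList adj v = (adj v).map Fin.val := by
  simp [nbrList]

theorem getD_flatten {α : Type*} (L : List (List α)) (v : ℕ) (hv : v < L.length) (j : ℕ)
    (hj : j < L[v].length) (x : α) :
    L.flatten.getD ((L.take v).flatten.length + j) x = L[v][j] := by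
  induction L generalizing v with
  | nil => simp at hv
  | cons a L ih =>
    cases v with
    | zero =>
      have hj' : j < a.length := by simpa using hj
      simp [List.getElem?_append_left hj', hj']
    | succ v =>
      have := ih v (by simpa using hv) (by simpa using hj)
      simp only [List.flatten_cons, List.take_succ_cons, List.length_append, List.getElem_cons_succ,
        add_assoc]
      rw [← this, List.getD_append_right _ _ _ _ (by omega), Nat.add_sub_cancel_left]

theorem input_off (I : Instance) (adj : Fin I.n → List (Fin I.n)) {v : ℕ} (hv : v ≤ I.n) :
    (I.input adj).arr 0 v = ((List.ofFn adj).take v).flatten.length := by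
  change cells _ v = _
  have : v < I.n + 1 := by omega
  simp [cells, List.getD_eq_getElem?_getD, this]

theorem input_nbr (I : Instance) (adj : Fin I.n → List (Fin I.n)) :
    (I.input adj).arr 1 = cells ((List.ofFn adj).flatten.map Fin.val) := by
  change cells _ = cells _
  simp [← List.map_eq_flatMap]

theorem input_holdsGraph {I : Instance} {adj : Fin I.n → List (Fin I.n)} (h : I.IsAdjLists adj) :
    HoldsGraph I.n (nbrList adj) (I.input adj) where
  reg0 := rfl
  off_zero := by rw [input_off I adj (by omega)]; simp
  off_succ v hv := by
    rw [input_off I adj (by omega), input_off I adj (by omega),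
      List.take_succ_eq_append_getElem (by simpa using hv)]
    simp [nbrList, hv]
  nbr v hv j hj := by
    rw [input_off I adj (by omega)]
    rw [input_nbr]
    have hj' : j < (adj ⟨v, hv⟩).length := by simpa [nbrList, hv] using hj
    have := getD_flatten ((List.ofFn adj).map (List.map Fin.val)) v (by simpa using hv) j
      (by simpa using hj') 0
    have e : ((List.map (List.map Fin.val) (List.ofFn adj)).take v).flatten.length =
        ((List.ofFn adj).take v).flatten.length := by
      rw [← List.map_take, ← List.map_flatten, List.length_map]
    rw [e, ← List.map_flatten] at this
    rw [cells, this]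
    simp [nbrList, hv]
  lt v hv u hu := by
    simp only [nbrList, hv, dite_true, List.mem_map] at hu
    obtain ⟨w, -, rfl⟩ := hu
    exact w.2
  nodup v hv := by
    simp only [nbrList, hv, dite_true, List.nodup_cons, List.mem_map, not_exists, not_and]
    refine ⟨fun w hw e => ?_, (h ⟨v, hv⟩).1.map Fin.val_injective⟩
    have := ((h ⟨v, hv⟩).2 w).1 hw
    exact this.ne (Fin.ext e.symm)

/-- Handshake lemma; it turns the cost of the neighbourhood loops into a bound in m. -/
theorem input_off_n {I : Instance} {adj : Fin I.n → List (Fin I.n)} (h : I.IsAdjLists adj) :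
    (I.input adj).arr 0 I.n = 2 * I.m := by
  classical
  rw [input_off I adj le_rfl, List.take_of_length_le (by simp), List.length_flatten, List.map_ofFn,
    List.sum_ofFn, Instance.m, Set.ncard_eq_toFinset_card']
  change _ = 2 * I.G.edgeFinset.card
  rw [← SimpleGraph.sum_degrees_eq_twice_card_edges]
  refine Finset.sum_congr rfl fun v _ => ?_
  rw [Function.comp, ← List.toFinset_card_of_nodup (h v).1, ← SimpleGraph.card_neighborFinset_eq_degree]
  congr 1
  ext u
  simp [(h v).2 u]

theorem input_left (I : Instance) (adj : Fin I.n → List (Fin I.n)) (v : Fin I.n) :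
    (I.input adj).arr 2 v = (I.pre v).elim 0 fun P => (P.left : ℕ) + 1 := by
  change cells _ v = _
  simp [cells, List.getD_eq_getElem?_getD]

theorem input_right (I : Instance) (adj : Fin I.n → List (Fin I.n)) (v : Fin I.n) :
    (I.input adj).arr 3 v = (I.pre v).elim 0 fun P => (P.right : ℕ) + 1 := by
  change cells _ v = _
  simp [cells, List.getD_eq_getElem?_getD]

theorem mem_cons_nbrList {I : Instance} {adj : Fin I.n → List (Fin I.n)} (h : I.IsAdjLists adj)
    (u v : Fin I.n) : (u : ℕ) ∈ (v : ℕ) :: nbrList adj v ↔ I.CAdj v u := by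
  rw [nbrList_coe, List.mem_cons, List.mem_map_of_injective Fin.val_injective, (h v).2 u,
    Instance.CAdj, Fin.val_inj, eq_comm]

/-! ## Running time -/

/-- The factor t⁴ from the check is absorbed because t² + t + 4 ≤ 2t² for t ≥ 3. For t = 0 both
counts vanish and 0⁰ = 1. -/
theorem search_cost_le {t F k : ℕ} (hF : 2 * F ≤ t * t + t) (hk : k ≤ 2 * (t * t)) :
    (t * t) ^ F * ((k + 1) * (k + 1)) ≤ 36 * t ^ (2 * t ^ 2) := by
  rcases Nat.eq_zero_or_pos t with rfl | ht
  · have h1 : F = 0 := by omega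
    have h2 : k = 0 := by omega
    simp [h1, h2]
  have e1 : (t * t) ^ F ≤ t ^ (t * t + t) := by
    rw [show (t * t) ^ F = t ^ (2 * F) by rw [← sq, ← pow_mul]]
    exact Nat.pow_le_pow_right ht hF
  have e2 : (k + 1) * (k + 1) ≤ 9 * t ^ 4 := by
    have : k + 1 ≤ 3 * (t * t) := by nlinarith
    calc (k + 1) * (k + 1) ≤ 3 * (t * t) * (3 * (t * t)) := Nat.mul_le_mul this this
      _ = 9 * t ^ 4 := by ring
  -- The factor 4 is forced by t = 2, where equality holds: 2¹⁰ = 4 · 2⁸.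
  have e3 : t ^ (t * t + t + 4) ≤ 4 * t ^ (2 * t ^ 2) := by
    rcases Nat.lt_or_ge t 3 with h | h
    · interval_cases t <;> norm_num
    · refine (Nat.pow_le_pow_right ht ?_).trans (Nat.le_mul_of_pos_left _ (by norm_num))
      nlinarith
  calc (t * t) ^ F * ((k + 1) * (k + 1)) ≤ t ^ (t * t + t) * (9 * t ^ 4) := Nat.mul_le_mul e1 e2
    _ = 9 * t ^ (t * t + t + 4) := by ring
    _ ≤ 9 * (4 * t ^ (2 * t ^ 2)) := Nat.mul_le_mul_left _ e3
    _ = 36 * t ^ (2 * t ^ 2) := by ring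

theorem table_cost_le (t : ℕ) : t * t + t + 1 ≤ 3 * t ^ (2 * t ^ 2) := by
  rcases Nat.eq_zero_or_pos t with rfl | ht
  · simp
  · have : t ^ 2 ≤ t ^ (2 * t ^ 2) := Nat.pow_le_pow_right ht (by nlinarith)
    nlinarith

/-! ## Correctness of the algorithm -/

/-- With all numbers below S, a cell index determines row and column as quotient and remainder, and
nonzero numbers determine their vertices. So non-representatives never touch a cell that is read. -/
theorem allOk_iff {b : Bool} {I : Instance} {num : Fin I.n → ℕ} {k F S : ℕ}
    (h : I.Numbering num k F) (hS : k < S) {M d : ℕ → ℕ}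
    (hM : ∀ x, M x = 1 ↔ ∃ u v, I.CAdj u v ∧ num u * S + num v = x) :
    AllOk b I.t k S M d ↔
      ∀ u v, num u ≠ 0 → num v ≠ 0 → EntryOk b I.t (I.CAdj u v) (d (num u)) (d (num v)) := by
  have key : ∀ u v, num u ≠ 0 → num v ≠ 0 → (M (num u * S + num v) = 1 ↔ I.CAdj u v) := by
    intro u v hu hv
    rw [hM]
    constructor
    · rintro ⟨u', v', huv, e⟩
      have hv1 := h.le v
      have hv2 := h.le v'
      have e1 := congrArg (· / S) e
      have e2 := congrArg (· % S) e
      simp only [mul_comm _ S, Nat.mul_add_div (by omega : 0 < S), Nat.mul_add_mod] at e1 e2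
      rw [Nat.mod_eq_of_lt (by omega), Nat.mod_eq_of_lt (by omega)] at e2
      rw [Nat.div_eq_of_lt (by omega), Nat.div_eq_of_lt (by omega)] at e1
      rw [h.inj u u' hu (by omega), h.inj v v' hv e2.symm]
      exact huv
    · exact fun huv => ⟨u, v, huv, rfl⟩
  constructor
  · intro H u v hu hv
    rw [← propext (key u v hu hv)]
    exact H _ (by omega) (h.le u) _ (by omega) (h.le v)
  · intro H i hi1 hi2 j hj1 hj2
    obtain ⟨u, rfl⟩ := h.surj i hi1 hi2
    obtain ⟨v, rfl⟩ := h.surj j hj1 hj2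
    rw [propext (key u v (by omega) (by omega))]
    exact H u v (by omega) (by omega)

theorem run_decideProg (b : Bool) {I : Instance} {num : Fin I.n → ℕ} {k F : ℕ}
    (h : I.Numbering num k F) {s : State} (h1 : s.reg 1 = I.t) (h2 : s.reg 2 = 1) (h3 : s.reg 3 = 0)
    (h4 : s.reg 4 = I.t * I.t) (h14 : s.reg 14 = 2 * (I.t * I.t) + 1) (h15 : s.reg 15 = k)
    (h17 : s.reg 17 = F)
    (h5 : ∀ c < I.t * I.t, s.arr 5 c = c / I.t ∧ s.arr 6 c = c % I.t)
    (hD : ∀ v, num v ≠ 0 → s.arr 14 (num v) = (I.pre v).elim 0 Subpath.code)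
    (hM : ∀ x, s.arr 15 x ≤ 1)
    (hM' : ∀ x, s.arr 15 x = 1 ↔ ∃ u v, I.CAdj u v ∧ num u * (2 * (I.t * I.t) + 1) + num v = x) :
    Runs (decideProg b) s (7200 * I.t ^ (2 * I.t ^ 2) + 20) fun s' =>
      (Problem b I → s'.reg 0 = 1) ∧ (¬ Problem b I → s'.reg 0 = 0) := by
  obtain ⟨Z, hZ⟩ : ∃ Z, Z = 7200 * I.t ^ (2 * I.t ^ 2) := ⟨_, rfl⟩
  rw [← hZ]
  unfold decideProg
  rw [block_cons]; refine Runs.eval_seq rfl (c := Z + 19) ?_ (by simp only [Prog.cost]; omega)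
  rw [block_cons]; refine Runs.eval_seq rfl (c := Z + 18) ?_ (by simp only [Prog.cost]; omega)
  rw [block_cons]; refine Runs.eval_seq rfl (c := Z + 17) ?_ (by simp only [Prog.cost]; omega)
  rw [block_cons]; refine Runs.eval_seq rfl (c := Z + 16) ?_ (by simp only [Prog.cost]; omega)
  rw [block_cons, block_singleton]
  obtain ⟨s₁, hs₁⟩ : ∃ s₁, s₁ = (Prog.add 12 4 4).eval ((Prog.add 11 4 1).eval
    ((Prog.add 10 17 17).eval ((const 19 0).eval s))) := ⟨_, rfl⟩
  rw [← hs₁]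
  have r₁ : ∀ r, r ≠ 10 → r ≠ 11 → r ≠ 12 → r ≠ 19 → s₁.reg r = s.reg r := by
    intro r g1 g2 g3 g4
    simp [hs₁, Prog.eval, State.setReg, g1, g2, g3, g4]
  have a₁ : s₁.arr = s.arr := by rw [hs₁]; rfl
  have e10 : s₁.reg 10 = 2 * F := by simp [hs₁, Prog.eval, State.setReg, h17]; ring
  have e11 : s₁.reg 11 = I.t * I.t + I.t := by simp [hs₁, Prog.eval, State.setReg, h4, h1]
  have e12 : s₁.reg 12 = 2 * (I.t * I.t) := by simp [hs₁, Prog.eval, State.setReg, h4]; ring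
  have e15 : s₁.reg 15 = k := by rw [r₁ 15 (by decide) (by decide) (by decide) (by decide), h15]
  have e3 : s₁.reg 3 = 0 := by rw [r₁ 3 (by decide) (by decide) (by decide) (by decide), h3]
  have e19 : s₁.reg 19 = 0 := by simp [hs₁, Prog.eval, State.setReg]
  suffices H : Runs (.ite 11 10 .skip (.ite 12 15 .skip (searchProg b))) s₁ (Z + 15) fun s' =>
      (Problem b I → s'.reg 19 = 1) ∧ (¬ Problem b I → s'.reg 19 = 0) by
    refine Runs.seq' H (d := 1) (fun s₂ hA hs₂ => Runs.eval rfl ?_) (by omega)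
    have f3 : s₂.reg 3 = 0 := by rw [hA.reg 3 (by cases b <;> rfl), e3]
    simpa [Prog.eval, State.setReg, f3] using hs₂
  by_cases c1 : s₁.reg 11 < s₁.reg 10
  · refine ⟨2, s₁, .ite_true c1 (.skip _), by omega, fun hP => ?_, fun _ => e19⟩
    have := (h.bounds hP).1
    omega
  have hF : 2 * F ≤ I.t * I.t + I.t := by omega
  by_cases c2 : s₁.reg 12 < s₁.reg 15
  · refine ⟨3, s₁, .ite_false c1 (.ite_true c2 (.skip _)), by omega, fun hP => ?_, fun _ => e19⟩
    have := (h.bounds hP).2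
    -- The test compares k with 2t², which is at least the proven bound t² + t because t ≤ t².
    nlinarith
  have hk : k ≤ 2 * (I.t * I.t) := by omega
  have hFt : I.t = 0 → F = 0 := fun e => by rw [e] at hF; omega
  have hlt : ∀ i, 1 ≤ i → i ≤ k → s.arr 14 i < I.t * I.t := by
    intro i hi1 hi2
    obtain ⟨v, rfl⟩ := h.surj i hi1 hi2
    rw [hD v (by omega)]
    cases hp : I.pre v with
    | none =>
      have := (h.free v (by omega)).2 hp
      -- A free representative starts with digit 0, which is below t² only for t > 0; for t = 0 the
      -- first test has left no free representative.
      have : 0 < I.t := Nat.pos_of_ne_zero fun e => by have := hFt e; omega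
      exact Nat.mul_pos this this
    | some P => exact P.code_lt
  obtain ⟨i, s₂, hE, hi, hR1, hR2⟩ := run_searchProg b (s := s₁) (t := I.t) (k := k)
    (S := 2 * (I.t * I.t) + 1) (F := F)
    (by rw [r₁ 2 (by decide) (by decide) (by decide) (by decide), h2]) e3
    (by rw [r₁ 4 (by decide) (by decide) (by decide) (by decide), h4])
    (by rw [r₁ 14 (by decide) (by decide) (by decide) (by decide), h14]) e15
    (by rw [r₁ 17 (by decide) (by decide) (by decide) (by decide), h17]) e19 h.le_k
    (by
      rcases Nat.eq_zero_or_pos I.t with e | e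
      · rw [hFt e, pow_zero]; omega
      · positivity)
    (by rw [a₁]; exact h5) (by rw [a₁]; exact hM) (by rw [a₁]; exact hlt)
    (by
      rw [a₁]
      intro i hi1 hi2
      obtain ⟨v, rfl⟩ := h.surj i hi1 (hi2.trans h.le_k)
      rw [hD v (by omega), (h.free v (by omega)).1 hi2]
      rfl)
  have hc := search_cost_le hF hk
  rw [a₁] at hR1 hR2
  rw [h.problem_iff (b := b) (D := s.arr 14) (fun v P hv hP => by rw [hD v hv, hP]; rfl)]
  simp only [allOk_iff h (by omega : k < 2 * (I.t * I.t) + 1) hM'] at hR1 hR2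
  exact ⟨i + 1 + 1, s₂, .ite_false c1 (.ite_false c2 hE), by omega, hR1, hR2⟩

/-- The labels of the vertices that the refinement starts with. -/
def Instance.label (I : Instance) (v : ℕ) : ℕ :=
  if h : v < I.n then (I.pre ⟨v, h⟩).elim (I.t * I.t) Subpath.code else 0

theorem Instance.label_coe (I : Instance) (v : Fin I.n) :
    I.label v = (I.pre v).elim (I.t * I.t) Subpath.code := by
  simp [Instance.label]

theorem Instance.label_eq_iff (I : Instance) (u v : Fin I.n) :
    I.label u = I.label v ↔ I.pre u = I.pre v := by
  rw [label_coe, label_coe]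
  cases hu : I.pre u with
  | none =>
    cases hv : I.pre v with
    | none => simp
    | some Q => simpa using Q.code_lt.ne'
  | some P =>
    cases hv : I.pre v with
    | none => simpa using P.code_lt.ne
    | some Q => simpa using ⟨Subpath.code_injective, fun e => by rw [e]⟩

theorem sameClass_label_iff {I : Instance} {adj : Fin I.n → List (Fin I.n)} (h : I.IsAdjLists adj)
    (u v : Fin I.n) : SameClass I.label (nbrList adj) I.n u v ↔ I.Twin u v := by
  rw [SameClass, I.label_eq_iff, Instance.Twin]
  refine and_congr_right fun _ => ⟨fun H w => ?_, fun H w hw => ?_⟩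
  · rw [← mem_cons_nbrList h, ← mem_cons_nbrList h]
    exact H w w.2
  · have := H ⟨w, hw⟩
    rwa [← mem_cons_nbrList h, ← mem_cons_nbrList h] at this

theorem SelInv.numbering {I : Instance} {adj : Fin I.n → List (Fin I.n)} (h : I.IsAdjLists adj)
    {cls lab : ℕ → ℕ} {S k base F : ℕ} {C : ℕ → Prop} {Φ : ℕ → ℕ → Prop} {A : ℕ → ℕ → ℕ}
    (hsel : SelInv I.n cls lab S C Φ k base A) (hC : ∀ u < I.n, C u)
    (hΦ : ∀ (v : Fin I.n) (i : ℕ), Φ v i → (i ≤ F ↔ I.pre v = none))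
    (hcls : ∀ u < I.n, ∀ w < I.n, (cls u = cls w ↔ SameClass I.label (nbrList adj) I.n u w))
    (hF : F ≤ k) : I.Numbering (fun v => A 12 v) k F where
  le v := hsel.le v
  surj i h1 h2 := by
    obtain ⟨v, hv⟩ := hsel.surj i h1 h2
    exact ⟨⟨v, hsel.lt v (by omega)⟩, hv⟩
  inj u v hu huv := Fin.ext (hsel.inj u v hu huv)
  twin_inj u v hu hv huv := Fin.ext <| hsel.cls_inj u v hu hv <|
    (hcls u u.2 v v.2).2 ((sameClass_label_iff h u v).2 huv)
  cover u := by
    obtain ⟨r, hr, hru⟩ := hsel.cover u u.2 (hC u u.2)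
    have hrn := hsel.lt r hr
    exact ⟨⟨r, hrn⟩, hr, (sameClass_label_iff h ⟨r, hrn⟩ u).1 ((hcls r hrn u u.2).1 hru)⟩
  free v hv := hΦ v _ (hsel.num v hv)
  le_k := hF

/-- Each phase contributes its own cost bound, and the frame rule carries registers and arrays past
the phases that do not write them. -/
theorem run_solver (b : Bool) {I : Instance} {adj : Fin I.n → List (Fin I.n)}
    (h : I.IsAdjLists adj) :
    Runs (solver b) (I.input adj) (10000 * (I.n + I.m + I.t ^ (2 * I.t ^ 2))) fun s' =>
      (Problem b I → s'.reg 0 = 1) ∧ (¬ Problem b I → s'.reg 0 = 0) := by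
  have hG := input_holdsGraph h
  have hm := input_off_n h
  have hL := input_left I adj
  have hR := input_right I adj
  obtain ⟨s, hs⟩ : ∃ s, s = I.input adj := ⟨_, rfl⟩
  have z : ∀ a, 4 ≤ a → ∀ x, s.arr a x = 0 := by
    intro a ha x
    obtain ⟨a, rfl⟩ := Nat.exists_eq_add_of_le' ha
    rw [hs]; rfl
  have h1 : s.reg 1 = I.t := by rw [hs]; rfl
  rw [← hs] at hG hm hL hR ⊢
  clear hs
  obtain ⟨X, hX⟩ : ∃ X, X = I.n + 2 * I.m + 1 := ⟨_, rfl⟩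
  obtain ⟨Z, hZ⟩ : ∃ Z, Z = 7200 * I.t ^ (2 * I.t ^ 2) + 20 := ⟨_, rfl⟩
  unfold solver
  rw [block_cons]
  -- The summands are the budgets of the remaining phases, in order of execution; each later `d` or
  -- `c` drops one of them.
  refine Runs.seq' (run_tableProg s) (d := 20 * I.n + 20 + (30 * X + (2 + (30 * (I.n + 1) +
    (1 + (30 * (I.n + 1) + (30 * X + Z))))))) ?_ ?_
  swap
  · have := table_cost_le I.t
    have : 1 ≤ I.t ^ (2 * I.t ^ 2) := by
      rcases Nat.eq_zero_or_pos I.t with e | e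
      · simp [e]
      · exact Nat.one_le_pow _ _ e
    rw [h1]
    omega
  rw [h1]
  rintro s₁ hA₁ ⟨p2, p3, p4, p14, p5, pm, pc⟩
  rw [block_cons]
  have p0 : s₁.reg 0 = I.n := (hA₁.reg 0 rfl).trans hG.reg0
  refine Runs.seq' (run_labelProg s₁ (I.t * I.t) p2 p3 p4) (d := 30 * X + (2 + (30 * (I.n + 1) +
    (1 + (30 * (I.n + 1) + (30 * X + Z)))))) ?_ (by rw [p0])
  rw [p0, hA₁.arr 2 rfl, hA₁.arr 3 rfl]
  intro s₂ hA₂ hlab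
  have hlab7 : ∀ v : Fin I.n, s₂.arr 7 v = I.label v ∧ s₂.arr 8 v = (I.pre v).elim 0 Subpath.code := by
    intro v
    have := hlab v v.2
    rw [hL, hR] at this
    rw [this.1, this.2, I.label_coe]
    cases hp : I.pre v with
    | none => simp
    | some P => simp [pm _ P.left.2, Subpath.code, ← add_assoc]
  have G₂ : HoldsGraph I.n (nbrList adj) s₂ := hG.congr ((hA₂.reg 0 rfl).trans (hA₁.reg 0 rfl))
    ((hA₂.arr 0 rfl).trans (hA₁.arr 0 rfl)) ((hA₂.arr 1 rfl).trans (hA₁.arr 1 rfl))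
  rw [block_cons]
  refine Runs.seq' (run_split G₂ (lab := I.label) ((hA₂.reg 2 rfl).trans p2) ((hA₂.reg 3 rfl).trans p3)
    (fun v hv => (hlab7 ⟨v, hv⟩).1) ?_ ?_) (d := 2 + (30 * (I.n + 1) +
    (1 + (30 * (I.n + 1) + (30 * X + Z))))) ?_ ?_
  · intro v hv
    rw [hA₂.reg 5 rfl, p5]
    rw [show v = ((⟨v, hv⟩ : Fin I.n) : ℕ) from rfl, I.label_coe]
    cases I.pre ⟨v, hv⟩ with
    | none => exact Nat.lt_succ_self _
    | some P => exact P.code_lt.trans (Nat.lt_succ_self _)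
  · intro c
    rw [hA₂.arr 9 rfl, hA₁.arr 9 rfl]; exact z 9 (by omega) c
  swap
  · rw [hA₂.arr 0 rfl, hA₁.arr 0 rfl, hm, hX]
  intro s₃ hA₃ hcls
  have q2 : s₃.reg 2 = 1 := by rw [hA₃.reg 2 rfl, hA₂.reg 2 rfl, p2]
  have q3 : s₃.reg 3 = 0 := by rw [hA₃.reg 3 rfl, hA₂.reg 3 rfl, p3]
  have q0 : s₃.reg 0 = I.n := by rw [hA₃.reg 0 rfl, hA₂.reg 0 rfl, p0]
  have q14 : s₃.reg 14 = 2 * (I.t * I.t) + 1 := by rw [hA₃.reg 14 rfl, hA₂.reg 14 rfl, p14]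
  have m2 : s₃.arr 2 = s.arr 2 := by rw [hA₃.arr 2 rfl, hA₂.arr 2 rfl, hA₁.arr 2 rfl]
  have m11 : s₃.arr 11 = s.arr 11 := by rw [hA₃.arr 11 rfl, hA₂.arr 11 rfl, hA₁.arr 11 rfl]
  have m12 : s₃.arr 12 = s.arr 12 := by rw [hA₃.arr 12 rfl, hA₂.arr 12 rfl, hA₁.arr 12 rfl]
  have m13 : s₃.arr 13 = s.arr 13 := by rw [hA₃.arr 13 rfl, hA₂.arr 13 rfl, hA₁.arr 13 rfl]
  have m8 : s₃.arr 8 = s₂.arr 8 := hA₃.arr 8 rfl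
  have hL' : ∀ v : Fin I.n, s.arr 2 v = 0 ↔ I.pre v = none := by
    intro v
    rw [hL]
    cases I.pre v <;> simp
  rw [block_cons]
  refine Runs.eval_seq rfl (c := 1 + (30 * (I.n + 1) +
    (1 + (30 * (I.n + 1) + (30 * X + Z))))) ?_ (by simp only [Prog.cost]; omega)
  rw [block_cons]
  refine Runs.eval_seq rfl (c := 30 * (I.n + 1) +
    (1 + (30 * (I.n + 1) + (30 * X + Z)))) ?_ (by simp only [Prog.cost]; omega)
  obtain ⟨s₄, hs₄⟩ : ∃ s₄, s₄ = (const 16 0).eval ((const 15 0).eval s₃) := ⟨_, rfl⟩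
  rw [← hs₄]
  have a₄ : s₄.arr = s₃.arr := by rw [hs₄]; rfl
  have r₄ : ∀ r, r ≠ 15 → r ≠ 16 → s₄.reg r = s₃.reg r := by
    intro r g1 g2
    simp [hs₄, Prog.eval, State.setReg, g1, g2]
  have r15 : s₄.reg 15 = 0 := by simp [hs₄, Prog.eval, State.setReg]
  have r16 : s₄.reg 16 = 0 := by simp [hs₄, Prog.eval, State.setReg]
  rw [block_cons]
  refine Runs.seq' (run_select (P := fun v => s.arr 2 v = 0) (n := I.n) (cls := s₃.arr 7)
    (lab := s₂.arr 8) (S := 2 * (I.t * I.t) + 1) (C := fun _ => False)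
    (Φ := fun v _ => s.arr 2 v = 0) ((r₄ 0 (by decide) (by decide)).trans q0)
    ((r₄ 2 (by decide) (by decide)).trans q2) ((r₄ 3 (by decide) (by decide)).trans q3)
    ((r₄ 14 (by decide) (by decide)).trans q14) (by rw [a₄]) (by rw [a₄, m8]) ?_
    (fun v _ hv _ _ => hv) ?_) (d := 1 + (30 * (I.n + 1) + (30 * X + Z))) ?_ le_rfl
  · intro s' g2 g3 v hv g10
    rw [g2, g10, a₄, m2, Nat.lt_one_iff]
  · rw [r15, r16, a₄]
    constructor <;> simp [m11, m12, m13, z 11, z 12, z 13]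
    omega
  rintro s₅ hA₅ ⟨hI₅, -⟩
  rw [block_cons]
  refine Runs.eval_seq rfl (c := 30 * (I.n + 1) + (30 * X + Z)) ?_ (by simp only [Prog.cost]; omega)
  obtain ⟨s₆, hs₆⟩ : ∃ s₆, s₆ = (Prog.add 17 15 3).eval s₅ := ⟨_, rfl⟩
  rw [← hs₆]
  have a₆ : s₆.arr = s₅.arr := by rw [hs₆]; rfl
  have r₆ : ∀ r, r ≠ 17 → s₆.reg r = s₅.reg r := by
    intro r g1
    simp [hs₆, Prog.eval, State.setReg, g1]
  have t3 : s₅.reg 3 = 0 := by rw [hA₅.reg 3 rfl, r₄ 3 (by decide) (by decide), q3]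
  have t17 : s₆.reg 17 = s₅.reg 15 := by simp [hs₆, Prog.eval, State.setReg, t3]
  obtain ⟨F, hF⟩ : ∃ F, F = s₅.reg 15 := ⟨_, rfl⟩
  have t2 : s₆.reg 2 = 1 := by rw [r₆ 2 (by decide), hA₅.reg 2 rfl, r₄ 2 (by decide) (by decide), q2]
  have n2 : s₆.arr 2 = s.arr 2 := by rw [a₆, hA₅.arr 2 rfl, a₄, m2]
  rw [block_cons]
  refine Runs.seq' (run_select (P := fun v => s.arr 2 v ≠ 0) (n := I.n) (cls := s₃.arr 7)
    (lab := s₂.arr 8) (S := 2 * (I.t * I.t) + 1) (C := fun v => False ∨ v < I.n ∧ s.arr 2 v = 0)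
    (Φ := fun v i => i ≤ F ↔ s.arr 2 v = 0)
    (by rw [r₆ 0 (by decide), hA₅.reg 0 rfl, r₄ 0 (by decide) (by decide), q0])
    t2 (by rw [r₆ 3 (by decide), t3])
    (by rw [r₆ 14 (by decide), hA₅.reg 14 rfl, r₄ 14 (by decide) (by decide), q14])
    (by rw [a₆, hA₅.arr 7 rfl, a₄]) (by rw [a₆, hA₅.arr 8 rfl, a₄, m8]) ?_
    ?_ ?_) (d := 30 * X + Z) ?_ le_rfl
  · intro s' g2 g3 v hv g10
    rw [g3, g10, n2, Nat.pos_iff_ne_zero]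
  · intro v hv hP i hi
    rw [r₆ 15 (by decide), ← hF] at hi
    exact iff_of_false (by omega) hP
  · rw [r₆ 15 (by decide), r₆ 16 (by decide), a₆]
    -- Only `Φ` changes between the passes: all numbers given so far are at most F and belong to
    -- free vertices.
    exact { hI₅ with num := fun v hv => iff_of_true (hF ▸ hI₅.le v) (hI₅.num v hv) }
  rintro s₇ hA₇ ⟨hI₇, hk₇⟩
  rw [r₆ 15 (by decide), ← hF] at hk₇
  have hnum : I.Numbering (fun v => s₇.arr 12 v) (s₇.reg 15) F :=
    hI₇.numbering h (fun u hu => by tauto) (fun v i hi => hi.trans (hL' v)) hcls hk₇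
  have G₇ : HoldsGraph I.n (nbrList adj) s₇ := by
    refine G₂.congr ?_ ?_ ?_
    · rw [hA₇.reg 0 rfl, r₆ 0 (by decide), hA₅.reg 0 rfl, r₄ 0 (by decide) (by decide), hA₃.reg 0 rfl]
    · rw [hA₇.arr 0 rfl, a₆, hA₅.arr 0 rfl, a₄, hA₃.arr 0 rfl]
    · rw [hA₇.arr 1 rfl, a₆, hA₅.arr 1 rfl, a₄, hA₃.arr 1 rfl]
  have u2 : s₇.reg 2 = 1 := by rw [hA₇.reg 2 rfl, t2]
  have u3 : s₇.reg 3 = 0 := by rw [hA₇.reg 3 rfl, r₆ 3 (by decide), t3]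
  rw [block_cons, block_singleton]
  refine Runs.seq' (run_matrix G₇ u2 u3 ?_) (d := Z) ?_ ?_
  · rw [hA₇.arr 15 rfl, a₆, hA₅.arr 15 rfl, a₄, hA₃.arr 15 rfl, hA₂.arr 15 rfl, hA₁.arr 15 rfl]
    exact z 15 (by omega)
  swap
  · rw [hA₇.arr 0 rfl, a₆, hA₅.arr 0 rfl, a₄, hA₃.arr 0 rfl, hA₂.arr 0 rfl, hA₁.arr 0 rfl, hm, hX]
  intro s₈ hA₈ hM
  have hreg : ∀ r ∈ [1, 4, 14], s₈.reg r = s₁.reg r := by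
    simp only [List.mem_cons, List.not_mem_nil, or_false]
    rintro r (rfl | rfl | rfl) <;>
    · rw [hA₈.reg _ rfl, hA₇.reg _ rfl, r₆ _ (by decide), hA₅.reg _ rfl,
        r₄ _ (by decide) (by decide), hA₃.reg _ rfl, hA₂.reg _ rfl]
  rw [hZ]
  refine run_decideProg b hnum (by rw [hreg 1 (by simp), hA₁.reg 1 rfl, h1]) (by rw [hA₈.reg 2 rfl, u2])
    (by rw [hA₈.reg 3 rfl, u3]) (by rw [hreg 4 (by simp), p4]) (by rw [hreg 14 (by simp), p14])
    (hA₈.reg 15 rfl) (by rw [hA₈.reg 17 rfl, hA₇.reg 17 rfl, t17, hF]) ?_ ?_ ?_ ?_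
  · rw [hA₈.arr 5 rfl, hA₇.arr 5 rfl, a₆, hA₅.arr 5 rfl, a₄, hA₃.arr 5 rfl, hA₂.arr 5 rfl,
      hA₈.arr 6 rfl, hA₇.arr 6 rfl, a₆, hA₅.arr 6 rfl, a₄, hA₃.arr 6 rfl, hA₂.arr 6 rfl]
    exact pc
  · intro v hv
    rw [hA₈.arr 14 rfl, hI₇.label v hv, (hlab7 v).2]
  · intro x
    rw [hM]
    split_ifs <;> omega
  · intro x
    rw [hM]
    simp only [ite_eq_left_iff, zero_ne_one, imp_false, not_not]
    constructor
    · rintro ⟨v, hv, u, hu, e⟩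
      have hun : u < I.n := by
        rcases List.mem_cons.1 hu with rfl | hu
        · exact hv
        · exact hG.lt v hv u hu
      exact ⟨⟨v, hv⟩, ⟨u, hun⟩, (mem_cons_nbrList h ⟨u, hun⟩ ⟨v, hv⟩).1 hu, by rw [← e, hI₇.row]⟩
    · rintro ⟨v, u, huv, e⟩
      exact ⟨v, v.2, u, (mem_cons_nbrList h u v).2 huv, by rw [← e, hI₇.row]⟩

/-! ### From the solver to the complexity statements -/

theorem decidesWithin_solver (b : Bool) :
    DecidesWithin (solver b) (Problem b) fun I => 10000 * (I.n + I.m + I.t ^ (2 * I.t ^ 2)) := by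
  intro I adj h
  obtain ⟨k, s, hE, hk, h1, h2⟩ := run_solver b h
  exact ⟨k, s, hE, hk, h1, h2⟩

theorem solvableInTimeO (b : Bool) :
    SolvableInTimeO (Problem b) fun I => I.n + I.m + I.t ^ (2 * I.t ^ 2) :=
  ⟨solver b, 10000, decidesWithin_solver b⟩

/-- Needed for the computability of the parameter function: power is iterated multiplication. -/
theorem primrec_pow : Primrec₂ fun a b : ℕ => a ^ b := by
  have : Primrec₂ fun a b : ℕ => Nat.rec (motive := fun _ => ℕ) 1 (fun _ y => y * a) b :=
    Primrec.nat_rec (f := fun _ : ℕ => 1) (g := fun (a : ℕ) (p : ℕ × ℕ) => p.2 * a)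
      (Primrec.const 1)
      (Primrec.nat_mul.comp (Primrec.snd.comp Primrec.snd) Primrec.fst)
  refine this.of_eq fun a b => ?_
  induction b with
  | zero => rfl
  | succ b ih => simp only [pow_succ, ← ih]

theorem isFPT (b : Bool) : IsFPT (Problem b) fun I => I.t := by
  -- The sum is turned into a product by A + N ≤ (A + 1)(N + 1), so exponent 1 suffices.
  refine ⟨solver b, fun t => 10000 * (t ^ (2 * (t * t)) + 1), 1, ?_, fun I adj h => ?_⟩
  · refine Primrec.to_comp ?_
    have hsq : Primrec fun t : ℕ => 2 * (t * t) :=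
      Primrec.nat_mul.comp (Primrec.const 2) (Primrec.nat_mul.comp Primrec.id Primrec.id)
    exact Primrec.nat_mul.comp (Primrec.const 10000)
      (Primrec.succ.comp (primrec_pow.comp Primrec.id hsq))
  · obtain ⟨k, s, hE, hk, h12⟩ := decidesWithin_solver b I adj h
    refine ⟨k, s, hE, hk.trans ?_, h12⟩
    change 10000 * (I.n + I.m + I.t ^ (2 * I.t ^ 2)) ≤
      10000 * (I.t ^ (2 * (I.t * I.t)) + 1) * (I.n + I.m + I.t + 1) ^ 1
    rw [pow_one, ← sq, mul_assoc]
    refine Nat.mul_le_mul_left _ ?_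
    nlinarith [Nat.zero_le (I.t ^ (2 * I.t ^ 2) * (I.n + I.m + I.t))]

end RepExt

theorem mainTheorem10 :
    (RepExt.IsFPT RepExt.RepExtPintFixed (fun I => I.t) ∧
      RepExt.IsFPT RepExt.RepExtIntFixed (fun I => I.t)) ∧
    (RepExt.SolvableInTimeO RepExt.RepExtPintFixed (fun I => I.n + I.m + I.t ^ (2 * I.t ^ 2)) ∧
      RepExt.SolvableInTimeO RepExt.RepExtIntFixed (fun I => I.n + I.m + I.t ^ (2 * I.t ^ 2))) := by
  have hp : RepExt.RepExtPintFixed = RepExt.Problem true :=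
    funext fun I => propext (RepExt.problem_true I).symm
  have hi : RepExt.RepExtIntFixed = RepExt.Problem false :=
    funext fun I => propext (RepExt.problem_false I).symm
  rw [hp, hi]
  exact ⟨⟨RepExt.isFPT true, RepExt.isFPT false⟩,
    RepExt.solvableInTimeO true, RepExt.solvableInTimeO false⟩
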